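/- All rings are commutative with $1$. **Definitions.** Let $R$ be a ring. If $L \subseteq F$ are $R$-modules with $F$ free, let $S = \operatorname{Sym}_R(F)$ and let $T$ be the $R$-subalgebra of $S$ generated by $L \subseteq F = S_1$; the integral closure $L^-_F$ of $L$ in $F$ is the set of $x \in F = S_1$ that are integral over $T$. If $L \subseteq M$ are arbitrary $R$-modules, choose a surjection $\pi : F \twoheadrightarrow M$ from a free $R$-module $F$; the *liftable integral closure* of $L$ in $M$ is $\operatorname{lic}(L \subseteq M) := \pi\big((\pi^{-1}(L))^-_F\big)$, which does not depend on the choice of $\pi$. For an ideal $I$ of $R$, $\bar I$ is its integral closure, i.e. the set of $z \in R$ satisfying an equation $z^n + a_1 z^{n-1} + \cdots + a_n = 0$ with $n \ge 1$ and $a_i \in I^i$ for $1 \le i \le n$. Put $$\tau_{\mathcal I} := \bigcap_{I \text{ ideal of } R} (I :_R \bar I).$$ **Proposition.** Let $(R,\mathfrak m)$ be a Noetherian local ring and let $d := \dim R$. Then $$\tau_{\mathcal I} \subseteq \operatorname{ann}_R \operatorname{lic}\big(0 \subseteq H^d_{\mathfrak m}(R)\big),$$ where $H^d_{\mathfrak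 m}(R) = \varinjlim_t \operatorname{Ext}^d_R(R/\mathfrak m^t, R)$ is the top local cohomology module, and equality holds whenever $R$ is Cohen–Macaulay (i.e. $\operatorname{depth} R = \dim R$) with infinite residue field. -/

import Mathlib

universe u v w w'

open IsLocalRing

noncomputable section

namespace LiftableIntegralClosure

section Modules

variable {R : Type u} [CommRing R]

/-- The integral closure `L⁻_F` of a submodule `L` of a free `R`-module `F`: the degree one part
of the integral closure, inside `S = Sym_R(F)`, of the `R`-subalgebra `T` of `S` generated by `L`.
The degree one part of `S` is identified with `F` through the canonical map `ι : F → S`. -/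
def icFree {F : Type v} [AddCommGroup F] [Module R F] [Module.Free R F] (L : Submodule R F) :
    Submodule R F :=
  ((Subalgebra.toSubmodule
      (integralClosure (Algebra.adjoin R (SymmetricAlgebra.ι R F '' (L : Set F)))
        (SymmetricAlgebra R F))).restrictScalars R).comap (SymmetricAlgebra.ι R F)

theorem mem_icFree {F : Type v} [AddCommGroup F] [Module R F] [Module.Free R F]
    (L : Submodule R F) (x : F) :
    x ∈ icFree L ↔ IsIntegral (Algebra.adjoin R (SymmetricAlgebra.ι R F '' (L : Set F)))
      (SymmetricAlgebra.ι R F x) :=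
  Iff.rfl

/-- `π(K⁻_F)` with `K = π⁻¹(L)`, for a linear map `π : F → M` from a free module `F`. It is
used for surjective `π`, where it depends on `L ⊆ M` only (see `licAlong_eq_lic`). -/
def licAlong {F : Type v} {M : Type w} [AddCommGroup F] [Module R F] [Module.Free R F]
    [AddCommGroup M] [Module R M] (π : F →ₗ[R] M) (L : Submodule R M) : Submodule R M :=
  (icFree (L.comap π)).map π

/-- The liftable integral closure of a submodule `L` of an arbitrary `R`-module `M`, computed from
the free module on the underlying set of `M` with its canonical surjection onto `M`. -/
def lic {M : Type w} [AddCommGroup M] [Module R M] (L : Submodule R M) : Submodule R M :=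
  licAlong (Finsupp.linearCombination R (id : M → M)) L

/-- Integral closure in free modules is functorial. -/
theorem map_mem_icFree {F : Type v} {G : Type w} [AddCommGroup F] [Module R F] [Module.Free R F]
    [AddCommGroup G] [Module R G] [Module.Free R G] (γ : F →ₗ[R] G) (U : Submodule R F)
    (V : Submodule R G) (h : U ≤ V.comap γ) {x : F} (hx : x ∈ icFree U) : γ x ∈ icFree V := by
  rw [mem_icFree] at hx ⊢
  set Γ : SymmetricAlgebra R F →ₐ[R] SymmetricAlgebra R G :=
    SymmetricAlgebra.lift (SymmetricAlgebra.ι R G ∘ₗ γ) with hΓ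
  have hι : ∀ y : F, Γ (SymmetricAlgebra.ι R F y) = SymmetricAlgebra.ι R G (γ y) := fun y => by
    rw [hΓ, SymmetricAlgebra.lift_ι_apply]; rfl
  have hmem : ∀ a : Algebra.adjoin R (SymmetricAlgebra.ι R F '' (U : Set F)),
      Γ a ∈ Algebra.adjoin R (SymmetricAlgebra.ι R G '' (V : Set G)) := by
    rintro ⟨a, ha⟩
    have h1 : Γ a ∈ (Algebra.adjoin R (SymmetricAlgebra.ι R F '' (U : Set F))).map Γ :=
      ⟨a, ha, rfl⟩
    rw [AlgHom.map_adjoin] at h1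
    refine Algebra.adjoin_mono ?_ h1
    rintro _ ⟨_, ⟨y, hy, rfl⟩, rfl⟩
    exact ⟨γ y, h hy, (hι y).symm⟩
  let φ : Algebra.adjoin R (SymmetricAlgebra.ι R F '' (U : Set F)) →+*
      Algebra.adjoin R (SymmetricAlgebra.ι R G '' (V : Set G)) :=
    ((Γ.toRingHom.comp (Subalgebra.val _).toRingHom).codRestrict
      (Algebra.adjoin R (SymmetricAlgebra.ι R G '' (V : Set G))) hmem)
  have := hx.map_of_comp_eq φ Γ.toRingHom (by ext a; rfl)
  rw [← hι]
  exact this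

/-- The liftable integral closure does not depend on the surjection from a free module. -/
theorem licAlong_le_licAlong {F : Type v} {G : Type w'} {M : Type w} [AddCommGroup F] [Module R F]
    [Module.Free R F] [AddCommGroup G] [Module R G] [Module.Free R G] [AddCommGroup M] [Module R M]
    (π : F →ₗ[R] M) (ρ : G →ₗ[R] M) (hρ : Function.Surjective ρ) (L : Submodule R M) :
    licAlong π L ≤ licAlong ρ L := by
  obtain ⟨γ, hγ⟩ := Module.projective_lifting_property ρ π hρ
  rintro _ ⟨x, hx, rfl⟩
  refine ⟨γ x, map_mem_icFree γ (L.comap π) (L.comap ρ) ?_ hx, ?_⟩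
  · rw [← Submodule.comap_comp, hγ]
  · rw [← hγ]; rfl

theorem licAlong_eq_lic {F : Type v} {M : Type w} [AddCommGroup F] [Module R F]
    [Module.Free R F] [AddCommGroup M] [Module R M]
    (π : F →ₗ[R] M) (hπ : Function.Surjective π) (L : Submodule R M) :
    licAlong π L = lic L :=
  le_antisymm
    (licAlong_le_licAlong π _ (Finsupp.linearCombination_id_surjective R M) L)
    (licAlong_le_licAlong _ π hπ L)

end Modules

section Ideals

variable (R : Type u) [CommRing R]

variable {R} in
/-- The integral closure `Ī` of an ideal `I`, as a set: the elements `z` that satisfy an equation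
`z ^ n + a₁ z ^ (n - 1) + ⋯ + aₙ = 0` with `n ≥ 1` and `aᵢ ∈ I ^ i` for `1 ≤ i ≤ n`. -/
def idealClosure (I : Ideal R) : Set R :=
  {z | ∃ (n : ℕ) (a : ℕ → R), 0 < n ∧ (∀ i ∈ Finset.Icc 1 n, a i ∈ I ^ i) ∧
    z ^ n + ∑ i ∈ Finset.Icc 1 n, a i * z ^ (n - i) = 0}

/-- The ideal `τ_𝓘 = ⋂_I (I : Ī)`, the intersection being over all ideals `I` of `R`. -/
def tauI : Ideal R :=
  ⨅ I : Ideal R, Submodule.colon I (idealClosure I)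

/-- The depth of a local ring: the supremum of the lengths of the regular sequences of elements
of the maximal ideal. -/
def depth [IsLocalRing R] : ℕ∞ :=
  ⨆ (rs : List R) (_ : (∀ r ∈ rs, r ∈ maximalIdeal R) ∧ RingTheory.Sequence.IsRegular R rs),
    (rs.length : ℕ∞)

/-- A (Noetherian) local ring is Cohen–Macaulay if its depth equals its Krull dimension. -/
def IsCohenMacaulay [IsLocalRing R] : Prop :=
  (depth R : WithBot ℕ∞) = ringKrullDim R

end Ideals

end LiftableIntegralClosure

end

namespace LiftableIntegralClosure

/-! ### Integral closure of ideals and of submodules of free modules. -/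

section IntegralClosure

open Polynomial

variable {R : Type u} [CommRing R]

/-! Write H for the top local cohomology module. The theorem holds because lic(0) in H is governed
by the integral closures of the annihilators of single elements of H.

For a system of parameters x_1, ..., x_d, H is the direct limit of the modules R/(x_1^t, ...,
x_d^t), so every finite subset of H lies in a cyclic submodule (`exists_cyclic_localCohomology`). An
element z of lic(0) lifts to a free module, where its integral equation involves finitely many
relations. If h generates a submodule of H containing everything involved, the lift can be pushed to
R, giving z = r h with r integral over ann(h). An element of τ multiplies r into ann(h), so it kills
z (`tauI_le_annihilator_lic_bot`).

Conversely, let a kill lic(0) and let z be integral over I. By Krull's intersection theorem I may be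
replaced by I + m^n, hence assumed m-primary. The infinite residue field gives a parameter ideal J
inside I over which I is integral (`exists_isParameterSystem_le_icFree`), and Cohen–Macaulayness
gives h in H with ann(h) = J (`exists_smul_eq_zero_iff`). Then z h lies in lic(0), so a z h = 0 and
a z lies in J, hence in I.

As H is defined as a colimit of Ext^d(R/m^t, R), its Koszul description comes from chain maps.
Koszul complexes of powers of the x_i map to resolutions of R/m^t because resolutions are exact.
Maps in the other direction exist at deep enough levels because Koszul homology in positive degrees
is pro-zero over a Noetherian ring. In the Cohen–Macaulay case the Koszul complex on the x_i is
exact, so the round trip is homotopic to the transition map, which acts on the top module as (x_1 ⋯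
x_d)^e.

The parameter ideal J is a reduction of I with the fewest generators. Such generators are
analytically independent, so more than d of them would make R/J^N longer than a system of parameters
permits (`le_of_forall_not_le_icFree`). -/

/-- Sym_R(R) and R[X] are matched by sending 1 to X. The maps in both directions carry the algebra
generated by I into the Rees algebra and back, so integrality passes across. -/
theorem mem_icFree_iff_isIntegral_reesAlgebra (I : Ideal R) (z : R) :
    z ∈ icFree I ↔ IsIntegral (reesAlgebra I) (monomial 1 z : R[X]) := by
  set Φ : SymmetricAlgebra R R →ₐ[R] R[X] := SymmetricAlgebra.lift (monomial 1) with hΦ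
  set Ψ : R[X] →ₐ[R] SymmetricAlgebra R R := aeval (SymmetricAlgebra.ι R R 1) with hΨ
  have hΦι (r : R) : Φ (SymmetricAlgebra.ι R R r) = monomial 1 r := by
    rw [hΦ, SymmetricAlgebra.lift_ι_apply]
  have hΨι (r : R) : Ψ (monomial 1 r) = SymmetricAlgebra.ι R R r := by
    rw [hΨ, aeval_monomial, pow_one, ← Algebra.smul_def, ← map_smul, smul_eq_mul, mul_one]
  have hmemΦ (a : Algebra.adjoin R (SymmetricAlgebra.ι R R '' (I : Set R))) :
      Φ a ∈ reesAlgebra I := by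
    have h1 : Φ a ∈ (Algebra.adjoin R (SymmetricAlgebra.ι R R '' (I : Set R))).map Φ :=
      ⟨a, a.2, rfl⟩
    rw [AlgHom.map_adjoin, ← Set.image_comp] at h1
    rw [← adjoin_monomial_eq_reesAlgebra]
    refine Algebra.adjoin_mono ?_ h1
    rintro _ ⟨y, hy, rfl⟩
    exact ⟨y, hy, (hΦι y).symm⟩
  have hmemΨ (a : reesAlgebra I) :
      Ψ a ∈ Algebra.adjoin R (SymmetricAlgebra.ι R R '' (I : Set R)) := by
    obtain ⟨a, ha⟩ := a
    rw [← adjoin_monomial_eq_reesAlgebra] at ha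
    have h1 : Ψ a ∈ (Algebra.adjoin R (Submodule.map (monomial 1 : R →ₗ[R] R[X]) I :
        Set R[X])).map Ψ := ⟨a, ha, rfl⟩
    rw [AlgHom.map_adjoin] at h1
    refine Algebra.adjoin_mono ?_ h1
    rintro _ ⟨_, ⟨y, hy, rfl⟩, rfl⟩
    exact ⟨y, hy, (hΨι y).symm⟩
  rw [mem_icFree]
  constructor
  · intro h
    rw [← hΦι]
    exact h.map_of_comp_eq ((Φ.toRingHom.comp (Subalgebra.val _).toRingHom).codRestrict _ hmemΦ)
      Φ.toRingHom (by ext a; rfl)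
  · intro h
    rw [← hΨι]
    exact h.map_of_comp_eq ((Ψ.toRingHom.comp (Subalgebra.val _).toRingHom).codRestrict _ hmemΨ)
      Ψ.toRingHom (by ext a; rfl)

/-- In an integral equation of degree n for zX over the Rees algebra, the coefficient of X^n is an
equation of ideal type: the coefficient of the (n - i)-th power contributes its part of degree i,
which lies in I^i. Conversely, use a_i X^i as coefficients. -/
theorem mem_icFree_iff_mem_idealClosure (I : Ideal R) (z : R) :
    z ∈ icFree I ↔ z ∈ idealClosure I := by
  rw [mem_icFree_iff_isIntegral_reesAlgebra]
  constructor
  · rintro ⟨p, hp, hz⟩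
    rcases subsingleton_or_nontrivial R with hR | hR
    · exact ⟨1, 0, one_pos, fun i _ => Submodule.zero_mem _,
        Subsingleton.elim _ _⟩
    have hpos : 0 < p.natDegree := by
      rw [Nat.pos_iff_ne_zero]
      intro h0
      rw [hp.natDegree_eq_zero.mp h0] at hz
      simp at hz
    refine ⟨p.natDegree, fun i => (p.coeff (p.natDegree - i) : R[X]).coeff i, hpos,
      fun i _ => (mem_reesAlgebra_iff I _).mp (p.coeff (p.natDegree - i)).2 i, ?_⟩
    rw [eval₂_eq_sum_range] at hz
    have h1 := congrArg (fun q : R[X] => q.coeff p.natDegree) hz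
    simp only [finsetSum_coeff, coeff_zero] at h1
    rw [← Finset.sum_range_reflect, Finset.sum_range_succ'] at h1
    rw [← h1, add_comm, Finset.range_eq_Ico, Finset.sum_Ico_add' (fun i =>
      ((algebraMap (reesAlgebra I) R[X]) (p.coeff (p.natDegree + 1 - 1 - i)) *
        (monomial 1 z : R[X]) ^ (p.natDegree + 1 - 1 - i)).coeff p.natDegree) 0 p.natDegree 1]
    have hI : Finset.Ico (0 + 1) (p.natDegree + 1) = Finset.Icc 1 p.natDegree := by
      rfl
    rw [hI]
    congr 1
    · refine Finset.sum_congr rfl fun i hi => ?_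
      rw [Finset.mem_Icc] at hi
      obtain ⟨k, hk⟩ := Nat.exists_eq_add_of_le hi.2
      simp only [monomial_pow, one_mul, Nat.add_sub_cancel]
      have hk' : p.natDegree - i = k := by omega
      rw [hk', ← C_mul_X_pow_eq_monomial, mul_comm (C _), ← mul_assoc]
      rw [coeff_mul_C]
      conv_rhs => rw [hk]
      rw [coeff_mul_X_pow]
      rfl
    · simp [monomial_pow, hp.coeff_natDegree]
  · rintro ⟨n, a, hn, ha, hz⟩
    let c : ℕ → reesAlgebra I := fun i => if h : i ∈ Finset.Icc 1 n then
      ⟨monomial i (a i), reesAlgebra.monomial_mem.mpr (ha i h)⟩ else 0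
    have hc : ∀ i ∈ Finset.Icc 1 n, (c i : R[X]) = monomial i (a i) := fun i hi => by
      simp only [c, dif_pos hi]
    refine ⟨X ^ n + ∑ i ∈ Finset.Icc 1 n, C (c i) * X ^ (n - i), ?_, ?_⟩
    · refine monic_X_pow_add (lt_of_le_of_lt (degree_sum_le _ _) ?_)
      rw [Finset.sup_lt_iff (by simp)]
      intro i hi
      rw [Finset.mem_Icc] at hi
      refine lt_of_le_of_lt (degree_C_mul_X_pow_le _ _) ?_
      exact_mod_cast (by omega : n - i < n)
    · rw [eval₂_add, eval₂_finsetSum]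
      simp only [eval₂_mul, eval₂_C, eval₂_pow, eval₂_X]
      have h2 : ∀ i ∈ Finset.Icc 1 n, algebraMap (reesAlgebra I) R[X] (c i) *
          (monomial 1 z) ^ (n - i) = monomial n (a i * z ^ (n - i)) := fun i hi => by
        have : algebraMap (reesAlgebra I) R[X] (c i) = monomial i (a i) := hc i hi
        rw [Finset.mem_Icc] at hi
        rw [this, monomial_pow, monomial_mul_monomial, one_mul, Nat.add_sub_cancel' hi.2]
      rw [Finset.sum_congr rfl h2, monomial_pow, one_mul, ← map_sum, ← map_add, hz, map_zero]

theorem icFree_mono {F : Type v} [AddCommGroup F] [Module R F] [Module.Free R F]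
    {L K : Submodule R F} (h : L ≤ K) : icFree L ≤ icFree K := fun _ hx =>
  map_mem_icFree LinearMap.id L K (by simpa using h) hx

theorem le_icFree {F : Type v} [AddCommGroup F] [Module R F] [Module.Free R F]
    (L : Submodule R F) : L ≤ icFree L := fun x hx =>
  (mem_icFree L x).mpr (isIntegral_algebraMap (x := (⟨_, Algebra.subset_adjoin ⟨x, hx, rfl⟩⟩ :
    Algebra.adjoin R (SymmetricAlgebra.ι R F '' (L : Set F)))))

theorem icFree_le_icFree_of_le {F : Type v} [AddCommGroup F] [Module R F] [Module.Free R F]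
    {L K : Submodule R F} (h : L ≤ icFree K) : icFree L ≤ icFree K := by
  intro x hx
  rw [mem_icFree] at hx ⊢
  set A := Algebra.adjoin R (SymmetricAlgebra.ι R F '' (K : Set F))
  have hle : Algebra.adjoin R (SymmetricAlgebra.ι R F '' (L : Set F)) ≤
      (integralClosure A (SymmetricAlgebra R F)).restrictScalars R := by
    refine Algebra.adjoin_le ?_
    rintro _ ⟨y, hy, rfl⟩
    exact h hy
  have h1 : IsIntegral (integralClosure A (SymmetricAlgebra R F)) (SymmetricAlgebra.ι R F x) :=
    hx.map_of_comp_eq (Subalgebra.inclusion hle).toRingHom (RingHom.id _) (by ext; rfl)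
  exact isIntegral_trans _ h1

/-- Integrality over the algebra generated by `L` involves only finitely many elements of `L`. -/
theorem exists_finset_mem_icFree_span {F : Type v} [AddCommGroup F] [Module R F] [Module.Free R F]
    {L : Submodule R F} {x : F} (hx : x ∈ icFree L) :
    ∃ s : Finset F, (s : Set F) ⊆ L ∧ x ∈ icFree (Submodule.span R (s : Set F)) := by
  classical
  rw [mem_icFree] at hx
  obtain ⟨p, hp, hpx⟩ := hx
  have hfin (a : Algebra.adjoin R (SymmetricAlgebra.ι R F '' (L : Set F))) :
      ∃ s : Finset F, (s : Set F) ⊆ L ∧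
        (a : SymmetricAlgebra R F) ∈ Algebra.adjoin R (SymmetricAlgebra.ι R F '' (s : Set F)) := by
    obtain ⟨a, ha⟩ := a
    induction ha using Algebra.adjoin_induction with
    | mem y hy =>
      obtain ⟨y, hy, rfl⟩ := hy
      exact ⟨{y}, by simpa using hy, Algebra.subset_adjoin ⟨y, by simp, rfl⟩⟩
    | algebraMap r => exact ⟨∅, by simp, Subalgebra.algebraMap_mem _ r⟩
    | add y z _ _ h1 h2 =>
      obtain ⟨s, hs, hs'⟩ := h1
      obtain ⟨t, ht, ht'⟩ := h2
      refine ⟨s ∪ t, by simp [hs, ht], add_mem ?_ ?_⟩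
      · exact Algebra.adjoin_mono (Set.image_mono (by simp)) hs'
      · exact Algebra.adjoin_mono (Set.image_mono (by simp)) ht'
    | mul y z _ _ h1 h2 =>
      obtain ⟨s, hs, hs'⟩ := h1
      obtain ⟨t, ht, ht'⟩ := h2
      refine ⟨s ∪ t, by simp [hs, ht], mul_mem ?_ ?_⟩
      · exact Algebra.adjoin_mono (Set.image_mono (by simp)) hs'
      · exact Algebra.adjoin_mono (Set.image_mono (by simp)) ht'
  choose s hsL hs using hfin
  refine ⟨(Finset.range (p.natDegree + 1)).biUnion fun i => s (p.coeff i), ?_, ?_⟩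
  · intro y hy
    simp only [Finset.coe_biUnion, Set.mem_iUnion] at hy
    obtain ⟨i, _, hy⟩ := hy
    exact hsL _ hy
  · rw [mem_icFree]
    set U := (Finset.range (p.natDegree + 1)).biUnion fun i => s (p.coeff i)
    set B := Algebra.adjoin R (SymmetricAlgebra.ι R F '' (Submodule.span R (U : Set F) : Set F))
    have hB : ∀ i, ((p.coeff i : Algebra.adjoin R (SymmetricAlgebra.ι R F '' (L : Set F))) :
        SymmetricAlgebra R F) ∈ B := by
      intro i
      by_cases hi : i ∈ Finset.range (p.natDegree + 1)
      · refine Algebra.adjoin_mono (Set.image_mono ?_) (hs (p.coeff i))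
        refine Set.Subset.trans ?_ Submodule.subset_span
        intro y hy
        exact Finset.mem_biUnion.mpr ⟨i, hi, hy⟩
      · rw [coeff_eq_zero_of_natDegree_lt (by simpa using hi)]
        exact zero_mem _
    have hq : p.map (algebraMap _ (SymmetricAlgebra R F)) ∈ lifts (algebraMap B _) := by
      rw [lifts_iff_coeff_lifts]
      intro i
      rw [coeff_map]
      exact ⟨⟨_, hB i⟩, rfl⟩
    rcases subsingleton_or_nontrivial (SymmetricAlgebra R F) with h0 | h0
    · exact ⟨X, monic_X, Subsingleton.elim _ _⟩
    obtain ⟨q, hq1, -, hq2⟩ := lifts_and_degree_eq_and_monic hq (hp.map _)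
    refine ⟨q, hq2, ?_⟩
    rw [eval₂_eq_eval_map, hq1, ← eval₂_eq_eval_map, hpx]

/-- If every finite subset of `M` is contained in a cyclic submodule, the liftable integral closure
of zero is made of the integral closures of the annihilators of elements. -/
theorem exists_mem_idealClosure_of_mem_lic_bot {M : Type w} [AddCommGroup M] [Module R M]
    (hM : ∀ s : Finset M, ∃ h : M, ∀ m ∈ s, ∃ r : R, r • h = m) {z : M}
    (hz : z ∈ lic (⊥ : Submodule R M)) :
    ∃ (h : M) (r : R), r • h = z ∧
      r ∈ idealClosure (LinearMap.ker (LinearMap.toSpanSingleton R M h) : Ideal R) := by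
  classical
  obtain ⟨x, hx, rfl⟩ := hz
  obtain ⟨s, hsL, hs⟩ := exists_finset_mem_icFree_span hx
  -- A single `h` must generate all basis vectors occurring in `x` and in the relations `s`, so that
  -- `γ` sends every relation into the annihilator of `h`.
  obtain ⟨h, hh⟩ := hM ((insert x s).biUnion fun y => y.support)
  choose! r hr using hh
  set γ : (M →₀ R) →ₗ[R] R := Finsupp.linearCombination R r
  have key : ∀ y ∈ insert x s, γ y • h = Finsupp.linearCombination R (id : M → M) y := by
    intro y hy
    simp only [γ, Finsupp.linearCombination_apply, Finsupp.sum, Finset.sum_smul, smul_assoc]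
    refine Finset.sum_congr rfl fun m hm => ?_
    rw [hr m (Finset.mem_biUnion.mpr ⟨y, hy, hm⟩), id]
  refine ⟨h, γ x, key x (Finset.mem_insert_self _ _), ?_⟩
  rw [← mem_icFree_iff_mem_idealClosure]
  refine map_mem_icFree γ (Submodule.span R (s : Set (M →₀ R))) _ ?_ hs
  rw [Submodule.span_le]
  intro y hy
  have h1 : Finsupp.linearCombination R (id : M → M) y = 0 := by simpa using hsL hy
  simp [key y (Finset.mem_insert_of_mem hy), h1]

theorem smul_mem_lic_bot {M : Type w} [AddCommGroup M] [Module R M] (h : M) {r : R}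
    (hr : r ∈ idealClosure (LinearMap.ker (LinearMap.toSpanSingleton R M h) : Ideal R)) :
    r • h ∈ lic (⊥ : Submodule R M) := by
  rw [← mem_icFree_iff_mem_idealClosure] at hr
  exact licAlong_le_licAlong (LinearMap.toSpanSingleton R M h) _
    (Finsupp.linearCombination_id_surjective R M) ⊥ ⟨r, hr, by simp⟩

end IntegralClosure

/-! ### Koszul complexes of powers as iterated mapping cones. -/

section Koszul

variable {R : Type u} [CommRing R]

/-- A tower of complexes of finite free modules on the same underlying modules: `d c` is the
differential of the complex of level `c` and `T e` is a chain map from level `c + e` to level `c`.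
The module `X (n + 1)` is placed in homological degree `n`. -/
structure ComplexTower (R : Type u) [CommRing R] where
  X : ℕ → Type u
  [acg : ∀ n, AddCommGroup (X n)]
  [mod : ∀ n, Module R (X n)]
  [fin : ∀ n, Module.Finite R (X n)]
  [free : ∀ n, Module.Free R (X n)]
  d : (c n : ℕ) → X (n + 1) →ₗ[R] X n
  T : (e n : ℕ) → X n →ₗ[R] X n
  d_d : ∀ c n y, d c n (d c (n + 1) y) = 0
  d_T : ∀ c e n y, d c n (T e (n + 1) y) = T e n (d (c + e) n y)
  T_zero : ∀ n y, T 0 n y = y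
  T_add : ∀ e e' n y, T (e + e') n y = T e n (T e' n y)

attribute [instance] ComplexTower.acg ComplexTower.mod ComplexTower.fin ComplexTower.free

namespace ComplexTower

/-- The modules of the mapping cone. -/
def ConeX (K : ComplexTower R) : ℕ → Type u
  | 0 => K.X 0
  | n + 1 => K.X (n + 1) × K.X n

instance (K : ComplexTower R) : ∀ n, AddCommGroup (K.ConeX n)
  | 0 => inferInstanceAs (AddCommGroup (K.X 0))
  | n + 1 => inferInstanceAs (AddCommGroup (K.X (n + 1) × K.X n))

instance (K : ComplexTower R) : ∀ n, Module R (K.ConeX n)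
  | 0 => inferInstanceAs (Module R (K.X 0))
  | n + 1 => inferInstanceAs (Module R (K.X (n + 1) × K.X n))

instance (K : ComplexTower R) : ∀ n, Module.Finite R (K.ConeX n)
  | 0 => inferInstanceAs (Module.Finite R (K.X 0))
  | n + 1 => inferInstanceAs (Module.Finite R (K.X (n + 1) × K.X n))

instance (K : ComplexTower R) : ∀ n, Module.Free R (K.ConeX n)
  | 0 => inferInstanceAs (Module.Free R (K.X 0))
  | n + 1 => inferInstanceAs (Module.Free R (K.X (n + 1) × K.X n))

/-- The differential of the mapping cone of multiplication by `x ^ c`. -/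
def coneD (K : ComplexTower R) (x : R) (c : ℕ) : (n : ℕ) → K.ConeX (n + 1) →ₗ[R] K.ConeX n
  | 0 => (K.d c 0 ∘ₗ LinearMap.fst R (K.X 1) (K.X 0) : K.X 1 × K.X 0 →ₗ[R] K.X 0) +
      x ^ c • LinearMap.snd R (K.X 1) (K.X 0)
  | n + 1 => ((K.d c (n + 1) ∘ₗ LinearMap.fst R (K.X (n + 2)) (K.X (n + 1)) +
      x ^ c • LinearMap.snd R (K.X (n + 2)) (K.X (n + 1))).prod
        (-(K.d c n ∘ₗ LinearMap.snd R (K.X (n + 2)) (K.X (n + 1)))) :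
        K.X (n + 2) × K.X (n + 1) →ₗ[R] K.X (n + 1) × K.X n)

/-- The transition maps of the mapping cone. -/
def coneT (K : ComplexTower R) (x : R) (e : ℕ) : (n : ℕ) → K.ConeX n →ₗ[R] K.ConeX n
  | 0 => K.T e 0
  | n + 1 => ((K.T e (n + 1)).prodMap (x ^ e • K.T e n) :
      K.X (n + 1) × K.X n →ₗ[R] K.X (n + 1) × K.X n)

theorem coneD_succ (K : ComplexTower R) (x : R) (c n : ℕ) (a : K.X (n + 2)) (b : K.X (n + 1)) :
    K.coneD x c (n + 1) (a, b) = (K.d c (n + 1) a + x ^ c • b, -K.d c n b) := rfl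

theorem coneT_succ (K : ComplexTower R) (x : R) (e n : ℕ) (a : K.X (n + 1)) (b : K.X n) :
    K.coneT x e (n + 1) (a, b) = (K.T e (n + 1) a, x ^ e • K.T e n b) := rfl

/-- The tower of mapping cones of the multiplications by the powers of `x`. -/
def cone (K : ComplexTower R) [Subsingleton (K.X 0)] (x : R) : ComplexTower R where
  X := K.ConeX
  d := K.coneD x
  T := K.coneT x
  d_d c n y := by
    cases n with
    -- Index 0 is homological degree -1, where the complex vanishes.
    | zero => exact Subsingleton.elim (α := K.X 0) _ _
    | succ n =>
      obtain ⟨a, b⟩ := y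
      rw [coneD_succ, coneD_succ]
      simp only [map_add, map_smul, map_neg, K.d_d, neg_neg, zero_add, smul_neg]
      exact Prod.ext (add_neg_cancel _) rfl
  d_T c e n y := by
    cases n with
    | zero => exact Subsingleton.elim (α := K.X 0) _ _
    | succ n =>
      obtain ⟨a, b⟩ := y
      rw [coneT_succ, coneD_succ, coneD_succ, coneT_succ]
      simp only [map_add, map_smul, map_neg, K.d_T, smul_neg, smul_smul, pow_add]
      rfl
  T_zero n y := by
    cases n with
    | zero => exact K.T_zero 0 y
    | succ n =>
      obtain ⟨a, b⟩ := y
      rw [coneT_succ, K.T_zero, K.T_zero, pow_zero, one_smul]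
  T_add e e' n y := by
    cases n with
    | zero => exact K.T_add e e' 0 y
    | succ n =>
      obtain ⟨a, b⟩ := y
      rw [coneT_succ, coneT_succ, coneT_succ, K.T_add, K.T_add, map_smul, pow_add, smul_smul]

/-- The modules of `R` placed in degree zero. -/
def UnitX (R : Type u) : ℕ → Type u
  | 0 => PUnit
  | 1 => R
  | _ + 2 => PUnit

instance (R : Type u) [CommRing R] : ∀ n, AddCommGroup (UnitX R n)
  | 0 => inferInstanceAs (AddCommGroup PUnit.{u + 1})
  | 1 => inferInstanceAs (AddCommGroup R)
  | _ + 2 => inferInstanceAs (AddCommGroup PUnit.{u + 1})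

instance : ∀ n, Module R (UnitX R n)
  | 0 => inferInstanceAs (Module R PUnit.{u + 1})
  | 1 => inferInstanceAs (Module R R)
  | _ + 2 => inferInstanceAs (Module R PUnit.{u + 1})

instance : ∀ n, Module.Finite R (UnitX R n)
  | 0 => inferInstanceAs (Module.Finite R PUnit.{u + 1})
  | 1 => inferInstanceAs (Module.Finite R R)
  | _ + 2 => inferInstanceAs (Module.Finite R PUnit.{u + 1})

instance : ∀ n, Module.Free R (UnitX R n)
  | 0 => inferInstanceAs (Module.Free R PUnit.{u + 1})
  | 1 => inferInstanceAs (Module.Free R R)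
  | _ + 2 => inferInstanceAs (Module.Free R PUnit.{u + 1})

variable (R) in
/-- The constant tower `R`. -/
def unit : ComplexTower R where
  X := UnitX R
  d _ _ := 0
  T _ _ := LinearMap.id
  d_d _ _ _ := rfl
  d_T _ _ _ _ := rfl
  T_zero _ _ := rfl
  T_add _ _ _ _ := rfl

/-- In the tower `K`, the homology in positive degrees is pro-zero. -/
def ProExact (K : ComplexTower R) : Prop :=
  ∀ c n, ∃ e, ∀ y : K.X (n + 2), K.d (c + e) (n + 1) y = 0 → ∃ w, K.d c (n + 2) w = K.T e (n + 2) y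

/-- The complex of level `c` is exact in positive degrees. -/
def ExactAtLevel (K : ComplexTower R) (c : ℕ) : Prop :=
  ∀ n, ∀ y : K.X (n + 2), K.d c (n + 1) y = 0 → ∃ w, K.d c (n + 2) w = y

/-- This is the long exact sequence of the cone, tracked through levels. For a cycle (a, b), `h2`
bounds a multiple of b by some w. Correcting a by a multiple of w gives a cycle of `K`, which `h1`
bounds one transition lower. Taking e = e' = 0 gives honest exactness. -/
theorem cone_exact_step (K : ComplexTower R) [Subsingleton (K.X 0)] (x : R) (c e e' n : ℕ)
    (h1 : ∀ a : K.X (n + 2), K.d (c + e) (n + 1) a = 0 → ∃ w, K.d c (n + 2) w = K.T e (n + 2) a)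
    (h2 : ∀ b : K.X (n + 1), K.d (c + e + e') n b = 0 →
      (∃ w, K.d (c + e + e') (n + 1) w = x ^ (c + e + e') • b) →
      ∃ w, K.d (c + e) (n + 1) w = x ^ e' • K.T e' (n + 1) b)
    (y : (K.cone x).X (n + 2)) (hy : (K.cone x).d (c + e + e') (n + 1) y = 0) :
    ∃ w, (K.cone x).d c (n + 2) w = (K.cone x).T (e + e') (n + 2) y := by
  obtain ⟨a, b⟩ := y
  change K.coneD x _ (n + 1) (a, b) = 0 at hy
  rw [coneD_succ] at hy
  have hy1 : K.d (c + e + e') (n + 1) a + x ^ (c + e + e') • b = 0 := congrArg Prod.fst hy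
  have hy2 : K.d (c + e + e') n b = 0 := neg_eq_zero.mp (congrArg Prod.snd hy)
  obtain ⟨w, hw⟩ := h2 b hy2 ⟨-a, by rw [map_neg, neg_eq_iff_add_eq_zero, hy1]⟩
  obtain ⟨v, hv⟩ := h1 (K.T e' (n + 2) a + x ^ (c + e) • w) (by
    rw [map_add, map_smul, hw, K.d_T, smul_smul, ← pow_add, ← map_smul, ← map_add, hy1, map_zero])
  refine ⟨(v, - (x ^ e • K.T e (n + 2) w)), ?_⟩
  change K.coneD x c (n + 2) (v, - (x ^ e • K.T e (n + 2) w)) = K.coneT x (e + e') (n + 2) (a, b)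
  rw [coneD_succ, coneT_succ, hv, K.T_add e e' (n + 2), K.T_add e e' (n + 1), map_neg, map_smul,
    K.d_T, hw, neg_neg]
  refine Prod.ext ?_ ?_
  · simp only [map_add, map_smul, smul_neg, smul_smul, pow_add]
    abel
  · simp only [map_smul, smul_smul, pow_add]

theorem exists_pow_smul_mem {M : Type v} [AddCommGroup M] [Module R M] [IsNoetherian R M]
    (N : Submodule R M) (x : R) : ∃ e, ∀ k, ∀ y : M, x ^ k • y ∈ N → x ^ e • y ∈ N := by
  let f : ℕ →o Submodule R M :=
    ⟨fun k => N.comap (LinearMap.lsmul R M (x ^ k)), monotone_nat_of_le_succ fun k y hy => by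
      simp only [Submodule.mem_comap, LinearMap.lsmul_apply] at hy ⊢
      rw [pow_succ', mul_smul]
      exact N.smul_mem _ hy⟩
  obtain ⟨e, he⟩ := monotone_stabilizes_iff_noetherian.mpr ‹_› f
  refine ⟨e, fun k y hy => ?_⟩
  have h1 : y ∈ f (max k e) := f.monotone (le_max_left k e) hy
  rw [← he _ (le_max_right k e)] at h1
  exact h1

/-- Since the submodules (B : x^k), with B the boundaries, stabilise, a high power of x kills the
x-power torsion of the homology. The transition map of the cone supplies that power on the shifted
summand. -/
theorem ProExact.cone {K : ComplexTower R} [IsNoetherianRing R] [Subsingleton (K.X 0)]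
    (hK : K.ProExact) (x : R) : (K.cone x).ProExact := by
  intro c n
  obtain ⟨e, he⟩ := hK c n
  obtain ⟨e', he'⟩ := exists_pow_smul_mem (LinearMap.range (K.d (c + e) (n + 1))) x
  refine ⟨e + e', fun y hy => K.cone_exact_step x c e e' n he ?_ y (by rw [← add_assoc] at hy; exact hy)⟩
  rintro b - ⟨w, hw⟩
  refine he' (c + e + e') _ ⟨K.T e' _ w, ?_⟩
  rw [K.d_T, hw, map_smul]

theorem ExactAtLevel.cone {K : ComplexTower R} [Subsingleton (K.X 0)] {c : ℕ}
    (hK : K.ExactAtLevel c) (x : R)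
    (hx : ∀ b : K.X 1, x ^ c • b ∈ LinearMap.range (K.d c 1) → b ∈ LinearMap.range (K.d c 1)) :
    (K.cone x).ExactAtLevel c := by
  intro n y hy
  obtain ⟨w, hw⟩ := K.cone_exact_step x c 0 0 n (fun a ha => by simpa [K.T_zero] using hK n a ha)
    (fun b hb hb' => by
      simp only [add_zero, K.T_zero, pow_zero, one_smul] at hb hb' ⊢
      cases n with
      | zero => exact hx b hb'
      | succ n => exact hK n b hb) y hy
  exact ⟨w, by rw [hw, (K.cone x).T_zero]⟩

end ComplexTower

open ComplexTower

variable (R) in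
/-- A Koszul complex tower together with the vanishing of its module in degree `-1`. -/
def koszulAux : List R → {K : ComplexTower R // Subsingleton (K.X 0)}
  | [] => ⟨ComplexTower.unit R, inferInstanceAs (Subsingleton PUnit)⟩
  | x :: xs => ⟨haveI := (koszulAux xs).2; (koszulAux xs).1.cone x, (koszulAux xs).2⟩

/-- The tower of the Koszul complexes of the powers of a sequence. -/
def koszul (xs : List R) : ComplexTower R := (koszulAux R xs).1

instance (xs : List R) : Subsingleton ((koszul xs).X 0) := (koszulAux R xs).2

/-- The ideal generated by the `c`-th powers of the elements of a sequence. -/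
def powIdeal (c : ℕ) (xs : List R) : Ideal R := Ideal.ofList (xs.map (· ^ c))

theorem powIdeal_cons (c : ℕ) (x : R) (xs : List R) :
    powIdeal c (x :: xs) = Ideal.span {x ^ c} ⊔ powIdeal c xs := by
  simp [powIdeal]

theorem mem_powIdeal_cons {c : ℕ} {x : R} {xs : List R} {r : R} :
    r ∈ powIdeal c (x :: xs) ↔ ∃ s, ∃ t ∈ powIdeal c xs, r = x ^ c * s + t := by
  rw [powIdeal_cons, Submodule.mem_sup]
  constructor
  · rintro ⟨y, hy, t, ht, rfl⟩
    obtain ⟨s, rfl⟩ := Ideal.mem_span_singleton'.mp hy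
    exact ⟨s, t, ht, by rw [mul_comm]⟩
  · rintro ⟨s, t, ht, rfl⟩
    exact ⟨_, Ideal.mem_span_singleton'.mpr ⟨s, mul_comm _ _⟩, t, ht, rfl⟩

theorem subsingleton_koszul (xs : List R) :
    ∀ n, xs.length + 1 < n → Subsingleton ((koszul xs).X n) := by
  induction xs with
  | nil =>
    rintro (_ | _ | n) hn
    · omega
    · simp at hn
    · exact inferInstanceAs (Subsingleton PUnit)
  | cons x xs ih =>
    rintro (_ | n) hn
    · omega
    · have h1 := ih (n + 1) (by simp at hn; omega)
      have h2 := ih n (by simpa using hn)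
      exact inferInstanceAs (Subsingleton ((koszul xs).X (n + 1) × (koszul xs).X n))

/-- The identification of the degree zero module of the Koszul complex with `R`. -/
def koszulAug : (xs : List R) → (koszul xs).X 1 →ₗ[R] R
  | [] => (LinearMap.id : R →ₗ[R] R)
  | _ :: xs => (koszulAug xs ∘ₗ LinearMap.fst R _ _ :
      (koszul xs).X 1 × (koszul xs).X 0 →ₗ[R] R)

/-- The identification of the top module of the Koszul complex with `R`. -/
def koszulTop : (xs : List R) → (koszul xs).X (xs.length + 1) →ₗ[R] R
  | [] => (LinearMap.id : R →ₗ[R] R)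
  | _ :: xs => (koszulTop xs ∘ₗ LinearMap.snd R _ _ :
      (koszul xs).X (xs.length + 2) × (koszul xs).X (xs.length + 1) →ₗ[R] R)

theorem koszulAug_bijective (xs : List R) : Function.Bijective (koszulAug xs) := by
  induction xs with
  | nil => exact Function.bijective_id
  | cons x xs ih =>
    refine ih.comp (f := (Prod.fst : (koszul xs).X 1 × (koszul xs).X 0 → _)) ⟨?_, ?_⟩
    · rintro ⟨a, b⟩ ⟨a', b'⟩ h
      exact Prod.ext h (Subsingleton.elim _ _)
    · exact fun a => ⟨(a, 0), rfl⟩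

theorem koszulTop_bijective (xs : List R) : Function.Bijective (koszulTop xs) := by
  induction xs with
  | nil => exact Function.bijective_id
  | cons x xs ih =>
    have := subsingleton_koszul xs (xs.length + 2) (by omega)
    refine ih.comp (f := (Prod.snd : (koszul xs).X (xs.length + 2) × _ → _)) ⟨?_, ?_⟩
    · rintro ⟨a, b⟩ ⟨a', b'⟩ h
      exact Prod.ext (Subsingleton.elim _ _) h
    · exact fun a => ⟨(0, a), rfl⟩

theorem koszulAug_T (xs : List R) (e : ℕ) (y : (koszul xs).X 1) :
    koszulAug xs ((koszul xs).T e 1 y) = koszulAug xs y := by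
  induction xs with
  | nil => rfl
  | cons x xs ih => exact ih (y : (koszul xs).X 1 × (koszul xs).X 0).1

/-- Each cone contributes a factor x^e on the shifted summand. On top cohomology the transition maps
are therefore multiplication by a power of the product, as in the limit of the R/(x_1^t, ...,
x_d^t). -/
theorem koszulTop_T (xs : List R) (e : ℕ) (y : (koszul xs).X (xs.length + 1)) :
    koszulTop xs ((koszul xs).T e _ y) = xs.prod ^ e * koszulTop xs y := by
  induction xs with
  | nil =>
    change (y : R) = (List.prod ([] : List R)) ^ e * (show R from y)
    rw [List.prod_nil, one_pow, one_mul]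
  | cons x xs ih =>
    obtain ⟨a, b⟩ : (koszul xs).X (xs.length + 2) × (koszul xs).X (xs.length + 1) := y
    change koszulTop xs (x ^ e • (koszul xs).T e _ b) = _ * koszulTop xs b
    rw [map_smul, ih, List.prod_cons, mul_pow, smul_eq_mul, mul_assoc]

theorem koszulAug_d_mem (xs : List R) (c : ℕ) (y : (koszul xs).X 2) :
    koszulAug xs ((koszul xs).d c 1 y) ∈ powIdeal c xs := by
  induction xs with
  | nil =>
    exact zero_mem (powIdeal c ([] : List R))
  | cons x xs ih =>
    obtain ⟨a, b⟩ : (koszul xs).X 2 × (koszul xs).X 1 := y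
    change koszulAug xs ((koszul xs).d c 1 a + x ^ c • b) ∈ _
    rw [mem_powIdeal_cons]
    exact ⟨koszulAug xs b, _, ih a, by rw [map_add, map_smul, smul_eq_mul, add_comm]⟩

theorem exists_koszulAug_d_eq (xs : List R) (c : ℕ) {r : R} (hr : r ∈ powIdeal c xs) :
    ∃ y, koszulAug xs ((koszul xs).d c 1 y) = r := by
  induction xs generalizing r with
  | nil =>
    refine ⟨0, ?_⟩
    have : r = 0 := by simpa [powIdeal] using hr
    rw [map_zero, map_zero, this]
  | cons x xs ih =>
    obtain ⟨s, t, ht, rfl⟩ := mem_powIdeal_cons.mp hr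
    obtain ⟨a, rfl⟩ := ih ht
    obtain ⟨b, rfl⟩ := (koszulAug_bijective xs).2 s
    refine ⟨((a, b) : (koszul xs).X 2 × (koszul xs).X 1), ?_⟩
    change koszulAug xs ((koszul xs).d c 1 a + x ^ c • b) = _
    rw [map_add, map_smul, smul_eq_mul, add_comm]

/-- Together with `exists_koszul_dual_d_eq` this computes the top cohomology of the dual complex as
R modulo `powIdeal c xs`. The cone differential has the two components x^c and -d, which matches
adding the generator x^c to the ideal. -/
theorem koszul_dual_d_mem (xs : List R) (c : ℕ) (ψ : (koszul xs).X xs.length →ₗ[R] R) :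
    ∃ r ∈ powIdeal c xs, ∀ y, ψ ((koszul xs).d c xs.length y) = r * koszulTop xs y := by
  induction xs with
  | nil =>
    refine ⟨0, zero_mem _, fun y => ?_⟩
    rw [zero_mul]
    exact map_zero ψ
  | cons x xs ih =>
    let ψ' : (koszul xs).X (xs.length + 1) × (koszul xs).X xs.length →ₗ[R] R := ψ
    obtain ⟨t, ht, h1⟩ := ih (ψ' ∘ₗ LinearMap.inr R _ _)
    obtain ⟨v, hv⟩ := (koszulTop_bijective xs).2 1
    refine ⟨x ^ c * ψ' (v, 0) + - t, mem_powIdeal_cons.mpr ⟨_, _, neg_mem ht, rfl⟩, fun y => ?_⟩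
    obtain ⟨a, b⟩ : (koszul xs).X (xs.length + 2) × (koszul xs).X (xs.length + 1) := y
    have := subsingleton_koszul xs (xs.length + 2) (by omega)
    obtain rfl : a = 0 := Subsingleton.elim _ _
    have hb : b = koszulTop xs b • v := (koszulTop_bijective xs).1 (by
      rw [map_smul, hv, smul_eq_mul, mul_one])
    have h2 : ψ' (b, 0) = koszulTop xs b * ψ' (v, 0) := by
      conv_lhs => rw [hb]
      rw [← smul_eq_mul, ← map_smul, Prod.smul_mk, smul_zero]
    have h3 := h1 b
    change ψ' ((koszul xs).d c _ 0 + x ^ c • b, -(koszul xs).d c _ b) = _ * koszulTop xs b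
    change ψ' (0, (koszul xs).d c _ b) = _ at h3
    have h4 : (((koszul xs).d c (xs.length + 1) 0 + x ^ c • b, -(koszul xs).d c _ b) :
        (koszul xs).X (xs.length + 1) × (koszul xs).X xs.length) =
        x ^ c • (b, 0) - (0, (koszul xs).d c _ b) := by
      refine Prod.ext ?_ ?_ <;> simp
    rw [h4, map_sub, map_smul, h2, h3, smul_eq_mul]
    ring

theorem exists_koszul_dual_d_eq (xs : List R) (c : ℕ) {r : R} (hr : r ∈ powIdeal c xs) :
    ∃ ψ : (koszul xs).X xs.length →ₗ[R] R,
      ∀ y, ψ ((koszul xs).d c xs.length y) = r * koszulTop xs y := by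
  induction xs generalizing r with
  | nil =>
    have : r = 0 := by simpa [powIdeal] using hr
    exact ⟨0, fun y => by simp [this]⟩
  | cons x xs ih =>
    obtain ⟨s, t, ht, rfl⟩ := mem_powIdeal_cons.mp hr
    obtain ⟨ψ, hψ⟩ := ih ht
    refine ⟨((s • koszulTop xs).coprod (-ψ) :
      (koszul xs).X (xs.length + 1) × (koszul xs).X xs.length →ₗ[R] R), fun y => ?_⟩
    obtain ⟨a, b⟩ : (koszul xs).X (xs.length + 2) × (koszul xs).X (xs.length + 1) := y
    have := subsingleton_koszul xs (xs.length + 2) (by omega)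
    obtain rfl : a = 0 := Subsingleton.elim _ _
    change s * koszulTop xs ((koszul xs).d c _ 0 + x ^ c • b) + -ψ (-(koszul xs).d c _ b) =
      _ * koszulTop xs b
    rw [map_zero, zero_add, map_smul, map_neg, neg_neg, hψ, smul_eq_mul]
    ring

theorem proExact_koszul [IsNoetherianRing R] (xs : List R) : (koszul xs).ProExact := by
  induction xs with
  | nil => exact fun c n => ⟨0, fun y _ => ⟨0, Subsingleton.elim (α := PUnit) _ _⟩⟩
  | cons x xs ih => exact ih.cone x

theorem exactAtLevel_koszul_nil (c : ℕ) : (koszul ([] : List R)).ExactAtLevel c :=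
  fun _ _ _ => ⟨0, Subsingleton.elim (α := PUnit) _ _⟩

theorem mem_range_koszul_d (xs : List R) (c : ℕ) (b : (koszul xs).X 1) :
    b ∈ LinearMap.range ((koszul xs).d c 1) ↔ koszulAug xs b ∈ powIdeal c xs := by
  constructor
  · rintro ⟨y, rfl⟩
    exact koszulAug_d_mem xs c y
  · intro h
    obtain ⟨y, hy⟩ := exists_koszulAug_d_eq xs c h
    exact ⟨y, (koszulAug_bijective xs).1 hy⟩

theorem exactAtLevel_koszul_cons {x : R} {xs : List R} {c : ℕ} (h : (koszul xs).ExactAtLevel c)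
    (hx : ∀ r, x ^ c * r ∈ powIdeal c xs → r ∈ powIdeal c xs) :
    (koszul (x :: xs)).ExactAtLevel c :=
  h.cone x fun b hb => by
    rw [mem_range_koszul_d] at hb ⊢
    rw [map_smul, smul_eq_mul] at hb
    exact hx _ hb

end Koszul

/-! ### Classes of cocycles in Ext and in local cohomology. -/

section LocalCohomology

open CategoryTheory Opposite Limits

variable {R : Type u} [CommRing R]

/-- The map on complexes of morphisms into `Y` induced by a chain map. -/
noncomputable def linearYonedaMap {K L : ChainComplex (ModuleCat.{u} R) ℕ} (g : K ⟶ L) (Y : ModuleCat.{u} R) :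
    L.linearYonedaObj R Y ⟶ K.linearYonedaObj R Y :=
  ((HomologicalComplex.unopFunctor _ _).map
    (((((linearYoneda R (ModuleCat.{u} R)).obj Y).rightOp.mapHomologicalComplex _).map g).op))

theorem unop_comp_unop_inv {V : Type v} [Category.{w} V] {X X' : Vᵒᵖ} {Y Y' : V} (e : X ≅ op Y)
    (e' : X' ≅ op Y') (f : X ⟶ X') (g : Y' ⟶ Y) (h : f ≫ e'.hom = e.hom ≫ g.op) :
    f.unop ≫ e.unop.inv = e'.unop.inv ≫ g := by
  rw [Iso.comp_inv_eq, Category.assoc, Iso.eq_inv_comp]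
  exact congrArg Quiver.Hom.unop h

theorem comp_comp_eq_of_eq {V : Type v} [Category.{w} V] {A A' B B' C C' : V} {a : A ⟶ A'}
    {p : A ⟶ B} {p' : A' ⟶ B'} {m : B ⟶ B'} {q : B ⟶ C} {q' : B' ⟶ C'} {k : C ⟶ C'}
    (h : a ≫ p' = p ≫ m) (h' : m ≫ q' = q ≫ k) : a ≫ p' ≫ q' = (p ≫ q) ≫ k := by
  rw [reassoc_of% h, h', Category.assoc]

theorem homologyUnop_inv_naturality {V : Type v} [Category.{w} V] [Abelian V] {ι : Type w'}
    {c : ComplexShape ι} {K L : HomologicalComplex Vᵒᵖ c} (φ : K ⟶ L) (i : ι) :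
    (HomologicalComplex.homologyMap φ i).unop ≫ (K.homologyUnop i).inv =
      (L.homologyUnop i).inv ≫
        HomologicalComplex.homologyMap ((HomologicalComplex.unopFunctor V c).map φ.op) i :=
  unop_comp_unop_inv (K.unop.homologyOp i) (L.unop.homologyOp i) (HomologicalComplex.homologyMap φ i)
    _ (HomologicalComplex.homologyOp_hom_naturality
      ((HomologicalComplex.unopFunctor V c).map φ.op) i)

/-- Ext is computed as a left derived functor into the opposite category. Naturality is thus that of
left derived objects followed by that of passing homology through `unop`. -/
theorem isoExt_hom_naturality {X X' : ModuleCat.{u} R} (f : X' ⟶ X)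
    (P : ProjectiveResolution X) (P' : ProjectiveResolution X')
    (g : P'.complex ⟶ P.complex) (comm : g.f 0 ≫ P.π.f 0 = P'.π.f 0 ≫ f)
    (n : ℕ) (Y : ModuleCat.{u} R) :
    ((Ext R (ModuleCat.{u} R) n).map f.op).app Y ≫ (P'.isoExt (R := R) n Y).hom =
      (P.isoExt (R := R) n Y).hom ≫ HomologicalComplex.homologyMap (linearYonedaMap g Y) n := by
  have h1 := congrArg Quiver.Hom.unop (ProjectiveResolution.isoLeftDerivedObj_inv_naturality
    f P' P g comm ((linearYoneda R (ModuleCat.{u} R)).obj Y).rightOp n)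
  rw [unop_comp, unop_comp] at h1
  have h2 := homologyUnop_inv_naturality
    ((((linearYoneda R (ModuleCat.{u} R)).obj Y).rightOp.mapHomologicalComplex _).map g) n
  exact comp_comp_eq_of_eq h1 h2

/-- The cycle given by an element of the kernel of the differential. -/
noncomputable def cyclesOfKer (C : CochainComplex (ModuleCat.{u} R) ℕ) (n : ℕ) :
    LinearMap.ker (C.d n (n + 1)).hom →ₗ[R] C.cycles n :=
  (C.liftCycles (ModuleCat.ofHom (LinearMap.ker (C.d n (n + 1)).hom).subtype) (n + 1) (by simp)
    (by ext y; exact y.2)).hom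

theorem iCycles_cyclesOfKer (C : CochainComplex (ModuleCat.{u} R) ℕ) (n : ℕ)
    (z : LinearMap.ker (C.d n (n + 1)).hom) : C.iCycles n (cyclesOfKer C n z) = z.1 :=
  congrArg (fun q => q.hom z) (C.liftCycles_i
    (ModuleCat.ofHom (LinearMap.ker (C.d n (n + 1)).hom).subtype) (n + 1) (by simp)
    (by ext y; exact y.2))

theorem iCycles_injective (C : CochainComplex (ModuleCat.{u} R) ℕ) (n : ℕ) :
    Function.Injective (C.iCycles n) :=
  (ModuleCat.mono_iff_injective (C.iCycles n)).mp inferInstance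

/-- The class in cohomology of a cocycle. -/
noncomputable def cocycleClass (C : CochainComplex (ModuleCat.{u} R) ℕ) (n : ℕ) :
    LinearMap.ker (C.d n (n + 1)).hom →ₗ[R] C.homology n :=
  (C.homologyπ n).hom ∘ₗ cyclesOfKer C n

theorem cocycleClass_apply (C : CochainComplex (ModuleCat.{u} R) ℕ) (n : ℕ)
    (z : LinearMap.ker (C.d n (n + 1)).hom) :
    cocycleClass C n z = C.homologyπ n (cyclesOfKer C n z) := rfl

theorem cocycleClass_surjective (C : CochainComplex (ModuleCat.{u} R) ℕ) (n : ℕ) :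
    Function.Surjective (cocycleClass C n) := by
  intro y
  obtain ⟨z, rfl⟩ := (ModuleCat.epi_iff_surjective (C.homologyπ n)).mp inferInstance y
  have hz : C.iCycles n z ∈ LinearMap.ker (C.d n (n + 1)).hom :=
    LinearMap.mem_ker.mpr (congrArg (fun q => q.hom z) (C.iCycles_d n (n + 1)))
  refine ⟨⟨C.iCycles n z, hz⟩, ?_⟩
  rw [cocycleClass_apply]
  congr 1
  exact iCycles_injective C n (iCycles_cyclesOfKer C n ⟨_, hz⟩)

theorem cocycleClass_eq_zero_iff (C : CochainComplex (ModuleCat.{u} R) ℕ) (n : ℕ)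
    (z : LinearMap.ker (C.d n (n + 1)).hom) :
    cocycleClass C n z = 0 ↔ ∃ y, C.d (n - 1) n y = z.1 := by
  -- At n = 0 the truncated `n - 1` is 0, which agrees with the convention prev 0 = 0, and the
  -- differential from 0 to 0 is zero.
  have hprev : (ComplexShape.up ℕ).prev n = n - 1 := by cases n <;> simp
  have hex := ShortComplex.exact_of_g_is_cokernel (.mk _ _ (C.toCycles_comp_homologyπ (n - 1) n))
    (C.homologyIsCokernel (n - 1) n hprev)
  rw [ShortComplex.moduleCat_exact_iff] at hex
  constructor
  · intro h
    obtain ⟨y, hy⟩ := hex _ h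
    refine ⟨y, ?_⟩
    rw [← iCycles_cyclesOfKer C n z, ← C.toCycles_i (n - 1) n]
    exact congrArg (C.iCycles n) hy
  · rintro ⟨y, hy⟩
    have h1 : C.toCycles (n - 1) n y = cyclesOfKer C n z := by
      apply iCycles_injective
      rw [iCycles_cyclesOfKer, ← hy]
      exact congrArg (fun q => q.hom y) (C.toCycles_i (n - 1) n)
    rw [cocycleClass_apply, ← h1]
    exact congrArg (fun q => q.hom y) (C.toCycles_comp_homologyπ (n - 1) n)

theorem homologyMap_cocycleClass {C D : CochainComplex (ModuleCat.{u} R) ℕ} (f : C ⟶ D) (n : ℕ)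
    (z : LinearMap.ker (C.d n (n + 1)).hom) (w : LinearMap.ker (D.d n (n + 1)).hom)
    (h : f.f n z.1 = w.1) :
    HomologicalComplex.homologyMap f n (cocycleClass C n z) = cocycleClass D n w := by
  have h1 := congrArg (fun q => q.hom (cyclesOfKer C n z))
    (HomologicalComplex.homologyπ_naturality f n)
  have h2 : HomologicalComplex.cyclesMap f n (cyclesOfKer C n z) = cyclesOfKer D n w := by
    apply iCycles_injective
    rw [iCycles_cyclesOfKer, ← h, ← iCycles_cyclesOfKer C n z]
    exact congrArg (fun q => q.hom (cyclesOfKer C n z)) (HomologicalComplex.cyclesMap_i f n)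
  rw [cocycleClass_apply, cocycleClass_apply, ← h2]
  exact h1

/-- The chosen projective resolution of `R ⧸ I ^ t`. -/
noncomputable abbrev powRes (I : Ideal R) (t : ℕ) :
    ProjectiveResolution (ModuleCat.of R (R ⧸ I ^ t)) :=
  projectiveResolution (ModuleCat.of R (R ⧸ I ^ t))

/-- The projection `R ⧸ I ^ s → R ⧸ I ^ t` for `t ≤ s`. -/
def powProj (I : Ideal R) {t s : ℕ} (h : t ≤ s) :
    ModuleCat.of R (R ⧸ I ^ s) ⟶ ModuleCat.of R (R ⧸ I ^ t) :=
  ModuleCat.ofHom (Submodule.mapQ _ _ LinearMap.id (Ideal.pow_le_pow_right h))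

/-- The structure map of the colimit defining local cohomology. -/
noncomputable def extToLocalCohomology (I : Ideal R) (n t : ℕ) :
    ((Ext R (ModuleCat.{u} R) n).obj (op (ModuleCat.of R (R ⧸ I ^ t)))).obj (ModuleCat.of R R) ⟶
      (localCohomology I n).obj (ModuleCat.of R R) :=
  have := localCohomology.hasColimitDiagram.{u, 0} (localCohomology.idealPowersDiagram I) n
  (colimit.ι (localCohomology.diagram (localCohomology.idealPowersDiagram I) n)
    (op (op t))).app (ModuleCat.of R R)

instance preservesFilteredColimitsOfSize_forget_moduleCat :
    PreservesFilteredColimitsOfSize.{0, 0} (forget (ModuleCat.{u} R)) :=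
  preservesSmallestFilteredColimits_of_preservesFilteredColimits.{u, u} _

theorem extToLocalCohomology_map (I : Ideal R) (n : ℕ) {t s : ℕ} (h : t ≤ s) :
    ((Ext R (ModuleCat.{u} R) n).map (powProj I h).op).app (ModuleCat.of R R) ≫
      extToLocalCohomology I n s = extToLocalCohomology I n t := by
  have := localCohomology.hasColimitDiagram.{u, 0} (localCohomology.idealPowersDiagram I) n
  have := congrArg (fun q => q.app (ModuleCat.of R R))
    (colimit.w (localCohomology.diagram (localCohomology.idealPowersDiagram I) n)
      (homOfLE h).op.op)
  exact this

theorem exists_extToLocalCohomology_eq (I : Ideal R) (n : ℕ)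
    (h : (localCohomology I n).obj (ModuleCat.of R R)) :
    ∃ t y, extToLocalCohomology I n t y = h := by
  have := localCohomology.hasColimitDiagram.{u, 0} (localCohomology.idealPowersDiagram I) n
  obtain ⟨t, y, hy⟩ := Concrete.isColimit_exists_rep _ (isColimitOfPreserves
    ((evaluation (ModuleCat.{u} R) (ModuleCat.{u} R)).obj (ModuleCat.of R R))
    (colimit.isColimit (localCohomology.diagram (localCohomology.idealPowersDiagram I) n))) h
  exact ⟨t.unop.unop, y, hy⟩

theorem exists_map_eq_zero_of_extToLocalCohomology_eq_zero (I : Ideal R) (n t : ℕ)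
    (y : ((Ext R (ModuleCat.{u} R) n).obj (op (ModuleCat.of R (R ⧸ I ^ t)))).obj (ModuleCat.of R R))
    (h : extToLocalCohomology I n t y = 0) :
    ∃ (s : ℕ) (hs : t ≤ s),
      ((Ext R (ModuleCat.{u} R) n).map (powProj I hs).op).app (ModuleCat.of R R) y = 0 := by
  have := localCohomology.hasColimitDiagram.{u, 0} (localCohomology.idealPowersDiagram I) n
  obtain ⟨s, f, g, hfg⟩ := (Concrete.isColimit_rep_eq_iff_exists _ (isColimitOfPreserves
    ((evaluation (ModuleCat.{u} R) (ModuleCat.{u} R)).obj (ModuleCat.of R R))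
    (colimit.isColimit (localCohomology.diagram (localCohomology.idealPowersDiagram I) n)))
    (i := op (op t)) (j := op (op t)) y 0).mp (h.trans (map_zero _).symm)
  refine ⟨s.unop.unop, leOfHom f.unop.unop, hfg.trans (map_zero _)⟩

/-- The class in local cohomology of a cocycle on the projective resolution of `R ⧸ I ^ t`. -/
noncomputable def lcClass (I : Ideal R) (n t : ℕ) :
    LinearMap.ker (((powRes I t).complex.linearYonedaObj R (ModuleCat.of R R)).d n (n + 1)).hom →ₗ[R]
      (localCohomology I n).obj (ModuleCat.of R R) :=
  ((((powRes I t).isoExt (R := R) n (ModuleCat.of R R)).inv) ≫ extToLocalCohomology I n t).hom ∘ₗ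
    cocycleClass ((powRes I t).complex.linearYonedaObj R (ModuleCat.of R R)) n

theorem lcClass_apply (I : Ideal R) (n t : ℕ) (z) :
    lcClass I n t z = extToLocalCohomology I n t (((powRes I t).isoExt n (ModuleCat.of R R)).inv
      (cocycleClass ((powRes I t).complex.linearYonedaObj R (ModuleCat.of R R)) n z)) := rfl

theorem exists_lcClass_eq (I : Ideal R) (n : ℕ)
    (h : (localCohomology I n).obj (ModuleCat.of R R)) : ∃ t z, lcClass I n t z = h := by
  obtain ⟨t, y, rfl⟩ := exists_extToLocalCohomology_eq I n h
  obtain ⟨z, hz⟩ := cocycleClass_surjective _ _ (((powRes I t).isoExt n (ModuleCat.of R R)).hom y)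
  refine ⟨t, z, ?_⟩
  rw [lcClass_apply, hz]
  congr 1
  exact congrArg (fun q => q.hom y) ((powRes I t).isoExt n (ModuleCat.of R R)).hom_inv_id

theorem ext_map_cocycleClass (I : Ideal R) (n : ℕ) {t s : ℕ} (h : t ≤ s)
    (g : (powRes I s).complex ⟶ (powRes I t).complex)
    (comm : g.f 0 ≫ (powRes I t).π.f 0 = (powRes I s).π.f 0 ≫ powProj I h)
    (z : LinearMap.ker (((powRes I t).complex.linearYonedaObj R (ModuleCat.of R R)).d n
      (n + 1)).hom)
    (w : LinearMap.ker (((powRes I s).complex.linearYonedaObj R (ModuleCat.of R R)).d n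
      (n + 1)).hom)
    (hzw : (linearYonedaMap g (ModuleCat.of R R)).f n z.1 = w.1) :
    ((Ext R (ModuleCat.{u} R) n).map (powProj I h).op).app (ModuleCat.of R R)
      (((powRes I t).isoExt n (ModuleCat.of R R)).inv (cocycleClass _ n z)) =
      ((powRes I s).isoExt n (ModuleCat.of R R)).inv (cocycleClass _ n w) := by
  have h1 := isoExt_hom_naturality (powProj I h) _ _ g comm n (ModuleCat.of R R)
  rw [← Iso.eq_comp_inv, Category.assoc] at h1
  rw [← homologyMap_cocycleClass _ n z w hzw]
  refine (congrArg (fun q => q.hom (((powRes I t).isoExt n (ModuleCat.of R R)).inv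
    (cocycleClass _ n z))) h1).trans ?_
  change ((powRes I s).isoExt n (ModuleCat.of R R)).inv ((HomologicalComplex.homologyMap (linearYonedaMap g _) n).hom
    (((powRes I t).isoExt n (ModuleCat.of R R)).hom _)) = _
  congr 2
  exact congrArg (fun q => q.hom (cocycleClass _ n z))
    ((powRes I t).isoExt n (ModuleCat.of R R)).inv_hom_id

theorem lcClass_eq_of_map (I : Ideal R) (n : ℕ) {t s : ℕ} (h : t ≤ s)
    (g : (powRes I s).complex ⟶ (powRes I t).complex)
    (comm : g.f 0 ≫ (powRes I t).π.f 0 = (powRes I s).π.f 0 ≫ powProj I h)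
    (z : LinearMap.ker (((powRes I t).complex.linearYonedaObj R (ModuleCat.of R R)).d n
      (n + 1)).hom)
    (w : LinearMap.ker (((powRes I s).complex.linearYonedaObj R (ModuleCat.of R R)).d n
      (n + 1)).hom)
    (hzw : (linearYonedaMap g (ModuleCat.of R R)).f n z.1 = w.1) :
    lcClass I n t z = lcClass I n s w := by
  rw [lcClass_apply, lcClass_apply, ← ext_map_cocycleClass I n h g comm z w hzw]
  exact congrArg (fun q => q.hom (((powRes I t).isoExt n (ModuleCat.of R R)).inv
    (cocycleClass _ n z))) (extToLocalCohomology_map I n h).symm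

/-- An element of a filtered colimit is zero only if it dies at a finite stage, where vanishing in
Ext means being a coboundary. -/
theorem exists_of_lcClass_eq_zero (I : Ideal R) (n t : ℕ) (z) (hz : lcClass I n t z = 0) :
    ∃ (s : ℕ) (hs : t ≤ s) (g : (powRes I s).complex ⟶ (powRes I t).complex),
      g.f 0 ≫ (powRes I t).π.f 0 = (powRes I s).π.f 0 ≫ powProj I hs ∧
      ∃ ψ : (powRes I s).complex.X (n - 1) ⟶ ModuleCat.of R R,
        (powRes I s).complex.d n (n - 1) ≫ ψ = g.f n ≫ (show _ ⟶ _ from z.1) := by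
  rw [lcClass_apply] at hz
  obtain ⟨s, hs, h0⟩ := exists_map_eq_zero_of_extToLocalCohomology_eq_zero I n t _ hz
  let g := ProjectiveResolution.lift (powProj I hs) (powRes I s) (powRes I t)
  have comm : g.f 0 ≫ (powRes I t).π.f 0 = (powRes I s).π.f 0 ≫ powProj I hs := by
    exact ProjectiveResolution.lift_commutes_zero _ _ _
  refine ⟨s, hs, g, comm, ?_⟩
  have hw : (linearYonedaMap g (ModuleCat.of R R)).f n z.1 ∈ LinearMap.ker
      (((powRes I s).complex.linearYonedaObj R (ModuleCat.of R R)).d n (n + 1)).hom := by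
    refine LinearMap.mem_ker.mpr ?_
    have := congrArg (fun q => q.hom z.1) ((linearYonedaMap g (ModuleCat.of R R)).comm n (n + 1))
    refine this.trans ?_
    have h2 := LinearMap.mem_ker.mp z.2
    change (linearYonedaMap g (ModuleCat.of R R)).f (n + 1) _ = 0
    exact (congrArg _ h2).trans (map_zero _)
  have h1 := ext_map_cocycleClass I n hs g comm z ⟨_, hw⟩ rfl
  have h3 : cocycleClass _ n ⟨_, hw⟩ = 0 := by
    refine (ModuleCat.mono_iff_injective ((powRes I s).isoExt (R := R) n
      (ModuleCat.of R R)).inv).mp inferInstance ?_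
    exact (h1.symm.trans h0).trans (map_zero _).symm
  obtain ⟨ψ, hψ⟩ := (cocycleClass_eq_zero_iff _ _ _).mp h3
  exact ⟨ψ, hψ⟩

end LocalCohomology

/-! ### Comparison of Koszul complexes with resolutions of the quotients by powers. -/

section TopLocalCohomology

open CategoryTheory Opposite Limits ComplexTower

variable {R : Type u} [CommRing R]

theorem exists_lift_of_forall_mem_range {P : Type v} {M : Type w} {N : Type w'} [AddCommGroup P]
    [Module R P] [Module.Projective R P] [AddCommGroup M] [Module R M] [AddCommGroup N] [Module R N]
    (f : P →ₗ[R] M) (g : N →ₗ[R] M) (h : ∀ y, f y ∈ LinearMap.range g) :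
    ∃ k : P →ₗ[R] N, ∀ y, g (k y) = f y := by
  obtain ⟨k, hk⟩ := Module.projective_lifting_property g.rangeRestrict (f.codRestrict _ h)
    g.surjective_rangeRestrict
  exact ⟨k, fun y => congrArg Subtype.val (LinearMap.congr_fun hk y)⟩

/-- Extension of a partial chain map by one degree. -/
theorem exists_extend_chainMap {A : ℕ → Type v} {B : ℕ → Type w} [∀ n, AddCommGroup (A n)]
    [∀ n, Module R (A n)] [∀ n, AddCommGroup (B n)] [∀ n, Module R (B n)]
    (dA : ∀ n, A (n + 1) →ₗ[R] A n) (dB : ∀ n, B (n + 1) →ₗ[R] B n) (n : ℕ)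
    [Module.Projective R (A (n + 1))] (f : ∀ i, A i →ₗ[R] B i)
    (hf : ∀ i < n, ∀ y, dB i (f (i + 1) y) = f i (dA i y))
    (h : ∀ y, f n (dA n y) ∈ LinearMap.range (dB n)) :
    ∃ f' : ∀ i, A i →ₗ[R] B i, f' 0 = f 0 ∧
      ∀ i < n + 1, ∀ y, dB i (f' (i + 1) y) = f' i (dA i y) := by
  obtain ⟨k, hk⟩ := exists_lift_of_forall_mem_range (f n ∘ₗ dA n) (dB n) h
  refine ⟨Function.update f (n + 1) k, Function.update_of_ne (by omega) _ _, fun i hi y => ?_⟩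
  rw [Function.update_of_ne (show i ≠ n + 1 by omega)]
  rcases Nat.lt_succ_iff_lt_or_eq.mp hi with h1 | rfl
  · rw [Function.update_of_ne (by omega), hf i h1]
  · rw [Function.update_self, hk]
    rfl

/-- Comparison of a complex of projectives with an exact complex. -/
theorem exists_chainMap_of_exact {A : ℕ → Type v} {B : ℕ → Type w} [∀ n, AddCommGroup (A n)]
    [∀ n, Module R (A n)] [∀ n, AddCommGroup (B n)] [∀ n, Module R (B n)]
    (dA : ∀ n, A (n + 1) →ₗ[R] A n) (dB : ∀ n, B (n + 1) →ₗ[R] B n)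
    [∀ n, Module.Projective R (A n)] (hA : ∀ n y, dA n (dA (n + 1) y) = 0)
    (hB : ∀ n y, dB n y = 0 → y ∈ LinearMap.range (dB (n + 1))) (f₀ : A 0 →ₗ[R] B 0)
    (hf₀ : ∀ y, f₀ (dA 0 y) ∈ LinearMap.range (dB 0)) (n : ℕ) :
    ∃ f : ∀ i, A i →ₗ[R] B i, f 0 = f₀ ∧ ∀ i < n, ∀ y, dB i (f (i + 1) y) = f i (dA i y) := by
  induction n with
  | zero => exact ⟨Function.update (fun _ => 0) 0 f₀, Function.update_self _ _ _, by simp⟩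
  | succ n ih =>
    obtain ⟨f, hf0, hf⟩ := ih
    obtain ⟨f', hf0', hf'⟩ := exists_extend_chainMap dA dB n f hf (by
      intro y
      cases n with
      | zero => rw [hf0]; exact hf₀ y
      | succ n => exact hB n _ (by rw [hf n (by omega), hA, map_zero]))
    exact ⟨f', hf0'.trans hf0, hf'⟩

theorem powIdeal_succ_le (c : ℕ) (xs : List R) : powIdeal (c + 1) xs ≤ powIdeal c xs := by
  induction xs with
  | nil => simp [powIdeal]
  | cons x xs ih =>
    intro r hr
    obtain ⟨s, t, ht, rfl⟩ := mem_powIdeal_cons.mp hr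
    exact mem_powIdeal_cons.mpr ⟨x * s, t, ih ht, by ring⟩

theorem powIdeal_antitone (xs : List R) : Antitone fun c => powIdeal c xs :=
  antitone_nat_of_succ_le fun c => powIdeal_succ_le c xs

theorem powIdeal_le_pow {I : Ideal R} {xs : List R} (h : ∀ x ∈ xs, x ∈ I) (c : ℕ) :
    powIdeal c xs ≤ I ^ c := by
  refine Ideal.span_le.mpr ?_
  intro y hy
  obtain ⟨x, hx, rfl⟩ := List.mem_map.mp hy
  exact Ideal.pow_mem_pow (h x hx) c

section Resolution

variable (I : Ideal R) (t : ℕ)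

instance (n : ℕ) : Module.Projective R ((powRes I t).complex.X n) :=
  (IsProjective.iff_projective ((powRes I t).complex.X n)).mpr ((powRes I t).projective n)

/-- The augmentation of the chosen resolution of `R ⧸ I ^ t`. -/
noncomputable def resAug : (powRes I t).complex.X 0 →ₗ[R] R ⧸ I ^ t := ((powRes I t).π.f 0).hom

theorem resAug_surjective : Function.Surjective (resAug I t) :=
  (ModuleCat.epi_iff_surjective ((powRes I t).π.f 0)).mp inferInstance

theorem resAug_d (y : (powRes I t).complex.X 1) :
    resAug I t ((powRes I t).complex.d 1 0 y) = 0 :=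
  congrArg (fun q => q.hom y) (powRes I t).complex_d_comp_π_f_zero

theorem res_d_d (n : ℕ) (y : (powRes I t).complex.X (n + 2)) :
    (powRes I t).complex.d (n + 1) n ((powRes I t).complex.d (n + 2) (n + 1) y) = 0 :=
  congrArg (fun q => q.hom y) ((powRes I t).complex.d_comp_d (n + 2) (n + 1) n)

theorem exists_d_eq_of_resAug_eq_zero (y : (powRes I t).complex.X 0) (hy : resAug I t y = 0) :
    ∃ w, (powRes I t).complex.d 1 0 w = y :=
  (ShortComplex.moduleCat_exact_iff _).mp (powRes I t).exact₀ y hy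

theorem exists_d_eq_of_d_eq_zero (n : ℕ) (y : (powRes I t).complex.X (n + 1))
    (hy : (powRes I t).complex.d (n + 1) n y = 0) :
    ∃ w, (powRes I t).complex.d (n + 2) (n + 1) w = y :=
  (ShortComplex.moduleCat_exact_iff _).mp ((powRes I t).exact_succ n) y hy

end Resolution

section Comparison

variable {I : Ideal R} {xs : List R}

/-- The Koszul complex maps to a resolution. -/
theorem exists_koszul_to_res {c t : ℕ} (hct : powIdeal c xs ≤ I ^ t) (n : ℕ) :
    ∃ g : ∀ i, (koszul xs).X (i + 1) →ₗ[R] (powRes I t).complex.X i,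
      (∀ y, resAug I t (g 0 y) = Ideal.Quotient.mk _ (koszulAug xs y)) ∧
      ∀ i < n, ∀ y, (powRes I t).complex.d (i + 1) i (g (i + 1) y) =
        g i ((koszul xs).d c (i + 1) y) := by
  obtain ⟨g₀, hg₀⟩ := exists_lift_of_forall_mem_range
    ((I ^ t).mkQ ∘ₗ koszulAug xs) (resAug I t) (fun y => resAug_surjective I t _)
  obtain ⟨g, hg0, hg⟩ := exists_chainMap_of_exact (A := fun i => (koszul xs).X (i + 1))
    (B := fun i => (powRes I t).complex.X i) (fun i => (koszul xs).d c (i + 1))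
    (fun i => ((powRes I t).complex.d (i + 1) i).hom) (fun i => (koszul xs).d_d c (i + 1))
    (fun i y hy => exists_d_eq_of_d_eq_zero I t i y hy) g₀ (fun y =>
      exists_d_eq_of_resAug_eq_zero I t _ (by
        rw [hg₀]
        exact (Submodule.Quotient.mk_eq_zero _).mpr (hct (koszulAug_d_mem xs c y)))) n
  exact ⟨g, fun y => by rw [hg0, hg₀]; rfl, hg⟩

/-- The Koszul complex need not be exact, so the usual lifting fails. Pro-exactness repairs it: each
further degree is reached by starting at a higher Koszul level and descending along `T`. -/
theorem exists_res_to_koszul_of_lt [IsNoetherianRing R] (hI : ∀ c, ∃ k, I ^ k ≤ powIdeal c xs)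
    (n t c : ℕ) :
    ∃ s, t ≤ s ∧ I ^ s ≤ powIdeal c xs ∧
      ∃ f : ∀ i, (powRes I s).complex.X i →ₗ[R] (koszul xs).X (i + 1),
      (∀ y r, resAug I s y = Ideal.Quotient.mk _ r → koszulAug xs (f 0 y) - r ∈ powIdeal c xs) ∧
      ∀ i < n + 1, ∀ y, (koszul xs).d c (i + 1) (f (i + 1) y) =
        f i ((powRes I s).complex.d (i + 1) i y) := by
  induction n generalizing c with
  | zero =>
    obtain ⟨k, hk⟩ := hI c
    have hs : I ^ max t k ≤ powIdeal c xs := (Ideal.pow_le_pow_right (le_max_right t k)).trans hk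
    refine ⟨max t k, le_max_left _ _, hs, ?_⟩
    obtain ⟨f₀, hf₀⟩ := exists_lift_of_forall_mem_range (resAug I (max t k))
      ((I ^ max t k).mkQ ∘ₗ koszulAug xs) (fun y =>
        ((I ^ max t k).mkQ_surjective.comp (koszulAug_bijective xs).2) _)
    have hf₀' : ∀ y r, resAug I (max t k) y = Ideal.Quotient.mk _ r →
        koszulAug xs (f₀ y) - r ∈ powIdeal c xs := fun y r h => by
      rw [← hf₀] at h
      exact hs (Ideal.Quotient.eq.mp h)
    obtain ⟨f, hf0, hf⟩ := exists_extend_chainMap (A := fun i => (powRes I (max t k)).complex.X i)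
      (B := fun i => (koszul xs).X (i + 1))
      (fun i => ((powRes I (max t k)).complex.d (i + 1) i).hom)
      (fun i => (koszul xs).d c (i + 1)) 0 (Function.update (fun _ => 0) 0 f₀) (by simp) (fun y => by
        rw [Function.update_self, mem_range_koszul_d]
        simpa using hf₀' _ 0 (by rw [map_zero]; exact resAug_d I _ y))
    refine ⟨f, ?_, hf⟩
    rw [hf0, Function.update_self]
    exact hf₀'
  | succ n ih =>
    -- The map is first built at level c + e. After `T e` the obstruction in the next degree, a
    -- cycle, becomes a boundary.
    obtain ⟨e, he⟩ := proExact_koszul xs c n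
    obtain ⟨s, hts, hs, f, hf0, hf⟩ := ih (c + e)
    have hle := powIdeal_antitone xs (Nat.le_add_right c e)
    refine ⟨s, hts, hs.trans hle, ?_⟩
    obtain ⟨f', hf0', hf'⟩ := exists_extend_chainMap (A := fun i => (powRes I s).complex.X i)
      (B := fun i => (koszul xs).X (i + 1))
      (fun i => ((powRes I s).complex.d (i + 1) i).hom) (fun i => (koszul xs).d c (i + 1)) (n + 1)
      (fun i => (koszul xs).T e (i + 1) ∘ₗ f i) (fun i hi y => by
        simp only [LinearMap.comp_apply]
        rw [(koszul xs).d_T, hf i hi]) (fun y => by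
        obtain ⟨w, hw⟩ := he (f (n + 1) ((powRes I s).complex.d (n + 2) (n + 1) y)) (by
          rw [hf n (by omega), res_d_d, map_zero])
        exact ⟨w, hw⟩)
    refine ⟨f', fun y r h => ?_, hf'⟩
    rw [hf0', LinearMap.comp_apply, koszulAug_T]
    exact hle (hf0 y r h)

/-- High enough resolutions map to the Koszul complex. -/
theorem exists_res_to_koszul [IsNoetherianRing R] (hI : ∀ c, ∃ k, I ^ k ≤ powIdeal c xs)
    (t c : ℕ) :
    ∃ s, t ≤ s ∧ ∃ f : ∀ i, (powRes I s).complex.X i →ₗ[R] (koszul xs).X (i + 1),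
      (∀ y r, resAug I s y = Ideal.Quotient.mk _ r → koszulAug xs (f 0 y) - r ∈ powIdeal c xs) ∧
      ∀ i y, (koszul xs).d c (i + 1) (f (i + 1) y) =
        f i ((powRes I s).complex.d (i + 1) i y) := by
  obtain ⟨s, hts, -, f, hf0, hf⟩ := exists_res_to_koszul_of_lt hI xs.length t c
  refine ⟨s, hts, f, hf0, fun i y => ?_⟩
  rcases lt_or_ge i (xs.length + 1) with h | h
  · exact hf i h y
  · have := subsingleton_koszul xs (i + 1) (by omega)
    exact Subsingleton.elim _ _

theorem exists_koszul_to_res_all {c t : ℕ} (hct : powIdeal c xs ≤ I ^ t) :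
    ∃ g : ∀ i, (koszul xs).X (i + 1) →ₗ[R] (powRes I t).complex.X i,
      (∀ y, resAug I t (g 0 y) = Ideal.Quotient.mk _ (koszulAug xs y)) ∧
      ∀ i y, (powRes I t).complex.d (i + 1) i (g (i + 1) y) =
        g i ((koszul xs).d c (i + 1) y) := by
  obtain ⟨g, hg0, hg⟩ := exists_koszul_to_res hct (xs.length + 1)
  refine ⟨g, hg0, fun i y => ?_⟩
  rcases lt_or_ge i (xs.length + 1) with h | h
  · exact hg i h y
  · have := subsingleton_koszul xs (i + 1) (by omega)
    have := subsingleton_koszul xs (i + 2) (by omega)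
    rw [Subsingleton.elim ((koszul xs).d c (i + 1) y) 0, Subsingleton.elim y 0]
    simp

/-- A map into the degree shifted Koszul complex homotopic to zero, up to a given degree. -/
theorem exists_homotopy {K : ComplexTower R} {c c' : ℕ} [Subsingleton (K.X 0)]
    (hK : K.ExactAtLevel c)
    (δ : ∀ n, K.X n →ₗ[R] K.X n) (hδ : ∀ n y, K.d c n (δ (n + 1) y) = δ n (K.d c' n y))
    (hδ1 : ∀ y, δ 1 y ∈ LinearMap.range (K.d c 1)) (N : ℕ) :
    ∃ h : ∀ n, K.X n →ₗ[R] K.X (n + 1), ∀ n < N, ∀ y,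
      δ (n + 1) y = K.d c (n + 1) (h (n + 1) y) + h n (K.d c' n y) := by
  induction N with
  | zero => exact ⟨fun _ => 0, by simp⟩
  | succ N ih =>
    obtain ⟨h, hh⟩ := ih
    obtain ⟨k, hk⟩ := exists_lift_of_forall_mem_range (δ (N + 1) - h N ∘ₗ K.d c' N)
      (K.d c (N + 1)) (by
        intro y
        cases N with
        | zero =>
          have : K.d c' 0 y = 0 := Subsingleton.elim _ _
          simpa [this] using hδ1 y
        | succ N =>
          refine hK N _ ?_
          have h1 := hh N (by omega) (K.d c' (N + 1) y)
          rw [K.d_d, map_zero, add_zero] at h1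
          rw [LinearMap.sub_apply, map_sub, hδ, LinearMap.comp_apply, h1, sub_self])
    refine ⟨Function.update h (N + 1) k, fun n hn y => ?_⟩
    rw [Function.update_of_ne (show n ≠ N + 1 by omega)]
    rcases Nat.lt_succ_iff_lt_or_eq.mp hn with h1 | rfl
    · rw [Function.update_of_ne (by omega), hh n h1]
    · rw [Function.update_self, hk, LinearMap.sub_apply, LinearMap.comp_apply, sub_add_cancel]

end Comparison

end TopLocalCohomology

/-! ### Cyclic submodules of top local cohomology and their annihilators. -/

section TopLocalCohomologyElements

open CategoryTheory Opposite Limits ComplexTower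

variable {R : Type u} [CommRing R]

/-- The cocycles computing `Ext n (R ⧸ I ^ t, R)`. -/
noncomputable abbrev resCocycles (I : Ideal R) (n t : ℕ) : Submodule R
    (((powRes I t).complex.linearYonedaObj R (ModuleCat.of R R)).X n) :=
  LinearMap.ker (((powRes I t).complex.linearYonedaObj R (ModuleCat.of R R)).d n (n + 1)).hom

/-- The linear form underlying a cocycle. -/
noncomputable def cocycleForm {I : Ideal R} {n t : ℕ} (z : resCocycles I n t) :
    (powRes I t).complex.X n →ₗ[R] R :=
  ModuleCat.Hom.hom (show (powRes I t).complex.X n ⟶ ModuleCat.of R R from z.1)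

/-- The cocycle given by a linear form. -/
noncomputable def mkCocycle {I : Ideal R} {n t : ℕ} (φ : (powRes I t).complex.X n →ₗ[R] R)
    (hφ : ∀ y, φ ((powRes I t).complex.d (n + 1) n y) = 0) : resCocycles I n t :=
  ⟨(ModuleCat.ofHom φ : (powRes I t).complex.X n ⟶ ModuleCat.of R R), by
    refine LinearMap.mem_ker.mpr ?_
    change (powRes I t).complex.d (n + 1) n ≫ ModuleCat.ofHom φ = 0
    ext y
    exact hφ y⟩

theorem cocycleForm_d {I : Ideal R} {n t : ℕ} (z : resCocycles I n t)
    (y : (powRes I t).complex.X (n + 1)) :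
    cocycleForm z ((powRes I t).complex.d (n + 1) n y) = 0 := by
  have h : (powRes I t).complex.d (n + 1) n ≫
    (show (powRes I t).complex.X n ⟶ ModuleCat.of R R from z.1) = 0 := LinearMap.mem_ker.mp z.2
  exact congrArg (fun q => q.hom y) h

theorem cocycleForm_smul {I : Ideal R} {n t : ℕ} (r : R) (z : resCocycles I n t) :
    cocycleForm (r • z) = r • cocycleForm z := rfl

/-- Two cocycles related by a lift of the projection have the same class. -/
theorem lcClass_eq_of_cocycleForm (I : Ideal R) (n : ℕ) {t s : ℕ} (h : t ≤ s)
    (f : ∀ i, (powRes I s).complex.X i →ₗ[R] (powRes I t).complex.X i)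
    (hf0 : ∀ y, resAug I t (f 0 y) = powProj I h (resAug I s y))
    (hf : ∀ i y, (powRes I t).complex.d (i + 1) i (f (i + 1) y) =
      f i ((powRes I s).complex.d (i + 1) i y))
    (z : resCocycles I n t) (w : resCocycles I n s)
    (hzw : ∀ y, cocycleForm z (f n y) = cocycleForm w y) : lcClass I n t z = lcClass I n s w := by
  let g : (powRes I s).complex ⟶ (powRes I t).complex :=
    { f := fun i => ModuleCat.ofHom (f i)
      comm' := by
        rintro i j (rfl : j + 1 = i)
        ext y
        exact hf j y }
  refine lcClass_eq_of_map I n h g ?_ z w ?_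
  · ext y
    exact hf0 y
  · refine ModuleCat.hom_ext (LinearMap.ext fun y => ?_)
    exact hzw y

theorem exists_lcClass_eq_of_le (I : Ideal R) (n : ℕ) {t s : ℕ} (h : t ≤ s)
    (z : resCocycles I n t) : ∃ w : resCocycles I n s, lcClass I n t z = lcClass I n s w := by
  let g := ProjectiveResolution.lift (powProj I h) (powRes I s) (powRes I t)
  refine ⟨mkCocycle (cocycleForm z ∘ₗ (g.f n).hom) fun y => ?_, ?_⟩
  · have h1 : g.f n ((powRes I s).complex.d (n + 1) n y) =
        (powRes I t).complex.d (n + 1) n (g.f (n + 1) y) :=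
      (congrArg (fun q => q.hom y) (g.comm (n + 1) n)).symm
    exact (congrArg (cocycleForm z) h1).trans (cocycleForm_d z _)
  · exact lcClass_eq_of_map I n h g (ProjectiveResolution.lift_commutes_zero _ _ _) z _ rfl

theorem lcClass_eq_zero_of_coboundary (I : Ideal R) (n t : ℕ) (z : resCocycles I n t)
    (ψ : (powRes I t).complex.X (n - 1) →ₗ[R] R)
    (h : ∀ y, ψ ((powRes I t).complex.d n (n - 1) y) = cocycleForm z y) : lcClass I n t z = 0 := by
  have h0 : cocycleClass _ n z = 0 := (cocycleClass_eq_zero_iff _ _ z).mpr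
    ⟨(ModuleCat.ofHom ψ : _ ⟶ ModuleCat.of R R), ModuleCat.hom_ext (LinearMap.ext h)⟩
  rw [lcClass_apply, h0]
  exact (congrArg _ (map_zero _)).trans (map_zero _)

section Koszul

variable {I : Ideal R} {xs : List R}

theorem exists_koszulTop_eq_one (xs : List R) :
    ∃ v, koszulTop xs v = 1 ∧ ∀ y, y = koszulTop xs y • v := by
  obtain ⟨v, hv⟩ := (koszulTop_bijective xs).2 1
  refine ⟨v, hv, fun y => (koszulTop_bijective xs).1 ?_⟩
  rw [map_smul, hv, smul_eq_mul, mul_one]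

/-- The class of the top component of a chain map from a resolution to the Koszul complex. -/
noncomputable def topCocycle {s c : ℕ}
    (f : ∀ i, (powRes I s).complex.X i →ₗ[R] (koszul xs).X (i + 1))
    (hf : ∀ i y, (koszul xs).d c (i + 1) (f (i + 1) y) =
        f i ((powRes I s).complex.d (i + 1) i y)) : resCocycles I xs.length s :=
  mkCocycle (koszulTop xs ∘ₗ f xs.length) fun y => by
    have := subsingleton_koszul xs (xs.length + 2) (by omega)
    rw [LinearMap.comp_apply, ← hf, Subsingleton.elim (f (xs.length + 1) y) 0, map_zero, map_zero]

theorem coboundary_koszul_mem {t c : ℕ}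
    (g : ∀ i, (koszul xs).X (i + 1) →ₗ[R] (powRes I t).complex.X i)
    (hg : ∀ i y, (powRes I t).complex.d (i + 1) i (g (i + 1) y) =
        g i ((koszul xs).d c (i + 1) y))
    (ψ : (powRes I t).complex.X (xs.length - 1) →ₗ[R] R) (y : (koszul xs).X (xs.length + 1)) :
    ψ ((powRes I t).complex.d xs.length (xs.length - 1) (g xs.length y)) ∈ powIdeal c xs := by
  cases xs with
  | nil =>
    have h : (powRes I t).complex.d ([] : List R).length (([] : List R).length - 1) = 0 :=
      (powRes I t).complex.shape 0 0 (by simp)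
    rw [h]
    exact (map_zero ψ).symm ▸ zero_mem _
  | cons x xs =>
    obtain ⟨r, hr, h⟩ := koszul_dual_d_mem (x :: xs) c (ψ ∘ₗ g xs.length)
    have h1 : ψ ((powRes I t).complex.d (xs.length + 1) xs.length (g (xs.length + 1) y)) =
        r * koszulTop (x :: xs) y := by rw [hg]; exact h y
    change ψ ((powRes I t).complex.d (xs.length + 1) xs.length (g (xs.length + 1) y)) ∈ _
    rw [h1]
    exact Ideal.mul_mem_right _ _ hr

theorem exists_coboundary_of_mem_powIdeal {s c : ℕ}
    (f : ∀ i, (powRes I s).complex.X i →ₗ[R] (koszul xs).X (i + 1))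
    (hf : ∀ i y, (koszul xs).d c (i + 1) (f (i + 1) y) =
        f i ((powRes I s).complex.d (i + 1) i y)) {r : R} (hr : r ∈ powIdeal c xs) :
    ∃ ψ : (powRes I s).complex.X (xs.length - 1) →ₗ[R] R, ∀ y,
      ψ ((powRes I s).complex.d xs.length (xs.length - 1) y) =
        r * koszulTop xs (f xs.length y) := by
  cases xs with
  | nil =>
    have : r = 0 := by simpa [powIdeal] using hr
    exact ⟨0, fun y => by simp [this]⟩
  | cons x xs =>
    obtain ⟨ψ, hψ⟩ := exists_koszul_dual_d_eq (x :: xs) c hr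
    refine ⟨ψ ∘ₗ f xs.length, fun y => ?_⟩
    rw [← hψ]
    exact congrArg ψ (hf xs.length y).symm

variable [IsNoetherianRing R]

/-- The classes of level `t` lie in a cyclic submodule of the top local cohomology module. -/
theorem exists_forall_lcClass_eq_smul (hxI : ∀ x ∈ xs, x ∈ I)
    (hI : ∀ c, ∃ k, I ^ k ≤ powIdeal c xs) (t : ℕ) :
    ∃ h : (localCohomology I xs.length).obj (ModuleCat.of R R),
      ∀ z, ∃ r : R, r • h = lcClass I xs.length t z := by
  have hct := powIdeal_le_pow hxI t
  obtain ⟨g, hg0, hg⟩ := exists_koszul_to_res_all hct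
  obtain ⟨s, hts, f, hf0, hf⟩ := exists_res_to_koszul hI t t
  obtain ⟨v, hv1, hv⟩ := exists_koszulTop_eq_one xs
  -- The composite `g i ∘ₗ f i` factors a lift of the projection from level s to level t through the
  -- Koszul complex. Its top module is free on `v`, so `z` pulls back to the multiple `cocycleForm z
  -- (g _ v)` of the top form.
  refine ⟨lcClass I xs.length s (topCocycle f hf), fun z => ⟨cocycleForm z (g _ v), ?_⟩⟩
  rw [← map_smul]
  refine (lcClass_eq_of_cocycleForm I xs.length hts (fun i => g i ∘ₗ f i) ?_ ?_ z _ ?_).symm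
  · intro y
    obtain ⟨r, hr⟩ := Ideal.Quotient.mk_surjective (resAug I s y)
    rw [LinearMap.comp_apply, hg0, ← hr]
    exact Ideal.Quotient.eq.mpr (hct (hf0 y r hr.symm))
  · intro i y
    rw [LinearMap.comp_apply, hg, hf, LinearMap.comp_apply]
  · intro y
    rw [cocycleForm_smul, LinearMap.comp_apply]
    conv_lhs => rw [hv (f _ y)]
    rw [map_smul, map_smul, LinearMap.smul_apply, smul_eq_mul, smul_eq_mul, mul_comm]
    rfl

/-- Every finite subset of the top local cohomology module is contained in a cyclic submodule. -/
theorem exists_cyclic_localCohomology (hxI : ∀ x ∈ xs, x ∈ I)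
    (hI : ∀ c, ∃ k, I ^ k ≤ powIdeal c xs)
    (S : Finset ((localCohomology I xs.length).obj (ModuleCat.of R R))) :
    ∃ h : (localCohomology I xs.length).obj (ModuleCat.of R R), ∀ m ∈ S, ∃ r : R, r • h = m := by
  choose t z hz using exists_lcClass_eq (R := R) I xs.length
  obtain ⟨h, hh⟩ := exists_forall_lcClass_eq_smul hxI hI (S.sup t)
  refine ⟨h, fun m hm => ?_⟩
  obtain ⟨w, hw⟩ := exists_lcClass_eq_of_le I xs.length (Finset.le_sup hm) (z m)
  rw [← hz m, hw]
  exact hh w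

/-- Under the exactness of the Koszul complex, `R ⧸ (x₁, …, x_d)` embeds into the top local
cohomology module. -/
theorem exists_smul_eq_zero_iff (hxI : ∀ x ∈ xs, x ∈ I)
    (hI : ∀ c, ∃ k, I ^ k ≤ powIdeal c xs) (hex : (koszul xs).ExactAtLevel 1)
    (hprod : ∀ e r, r * xs.prod ^ e ∈ powIdeal (1 + e) xs → r ∈ powIdeal 1 xs) :
    ∃ h : (localCohomology I xs.length).obj (ModuleCat.of R R),
      ∀ r : R, r • h = 0 ↔ r ∈ powIdeal 1 xs := by
  obtain ⟨s, -, f, hf0, hf⟩ := exists_res_to_koszul hI 0 1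
  refine ⟨lcClass I xs.length s (topCocycle f hf), fun r => ⟨fun hr => ?_, fun hr => ?_⟩⟩
  · rw [← map_smul] at hr
    obtain ⟨e, hse, G, hG0, ψ, hψ⟩ := exists_of_lcClass_eq_zero I xs.length s _ hr
    -- The level 1 + e is the source of the transition map `T e` to level 1, and it is deep enough
    -- to map to the resolution of level e.
    have hc : powIdeal (1 + e) xs ≤ I ^ e :=
      (powIdeal_le_pow hxI (1 + e)).trans (Ideal.pow_le_pow_right (by omega))
    obtain ⟨g, hg0, hg⟩ := exists_koszul_to_res_all hc
    obtain ⟨v, hv1, hv⟩ := exists_koszulTop_eq_one xs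
    have hGd (i : ℕ) (y : (powRes I e).complex.X (i + 1)) :
        G.f i ((powRes I e).complex.d (i + 1) i y) =
          (powRes I s).complex.d (i + 1) i (G.f (i + 1) y) :=
      (congrArg (fun q => q.hom y) (G.comm (i + 1) i)).symm
    have hGaug (y : (powRes I e).complex.X 0) :
        resAug I s (G.f 0 y) = powProj I hse (resAug I e y) :=
      congrArg (fun q => q.hom y) hG0
    let u : ∀ i, (koszul xs).X (i + 1) →ₗ[R] (koszul xs).X (i + 1) :=
      fun i => f i ∘ₗ (G.f i).hom ∘ₗ g i
    have hu (i : ℕ) (y) : (koszul xs).d 1 (i + 1) (u (i + 1) y) =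
        u i ((koszul xs).d (1 + e) (i + 1) y) := by
      change (koszul xs).d 1 (i + 1) (f (i + 1) (G.f (i + 1) (g (i + 1) y))) =
        f i (G.f i (g i _))
      rw [hf, ← hg, hGd]
    -- Both `u` and `T e` lift the same map on degree-zero homology, from level 1 + e to the exact
    -- complex of level 1. Their difference is therefore null-homotopic.
    let δ : ∀ n, (koszul xs).X n →ₗ[R] (koszul xs).X n := fun n => match n with
      | 0 => 0
      | i + 1 => u i - (koszul xs).T e (i + 1)
    obtain ⟨k, hk⟩ := exists_homotopy (c' := 1 + e) hex δ (by
        rintro (_ | n) y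
        · exact Subsingleton.elim _ _
        · change (koszul xs).d 1 (n + 1) (u (n + 1) y - (koszul xs).T e (n + 2) y) =
            u n _ - (koszul xs).T e (n + 1) _
          rw [map_sub, hu, (koszul xs).d_T]) (by
        intro y
        rw [mem_range_koszul_d]
        change koszulAug xs (f 0 (G.f 0 (g 0 y)) - (koszul xs).T e 1 y) ∈ _
        rw [map_sub, koszulAug_T]
        refine hf0 _ _ ?_
        rw [hGaug, hg0]
        rfl) (xs.length + 1)
    -- Above the top degree the Koszul module is zero, so only the term (homotopy) ∘ d survives. By
    -- duality its value on `v` lies in `powIdeal (1 + e) xs`: thus `u` agrees with multiplication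
    -- by the power of the product modulo that ideal.
    have h1 := hk xs.length (by omega) v
    have := subsingleton_koszul xs (xs.length + 2) (by omega)
    rw [Subsingleton.elim ((k (xs.length + 1)) v) 0, map_zero, zero_add] at h1
    have h2 := congrArg (koszulTop xs) h1
    obtain ⟨r₂, hr₂, hr₂'⟩ := koszul_dual_d_mem xs (1 + e) (koszulTop xs ∘ₗ k xs.length)
    have h3 := hr₂' v
    rw [LinearMap.comp_apply, ← h2, hv1, mul_one] at h3
    change koszulTop xs (u xs.length v - (koszul xs).T e (xs.length + 1) v) = r₂ at h3
    rw [map_sub, koszulTop_T, hv1, mul_one] at h3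
    have hψ' (y : (powRes I e).complex.X xs.length) :
        ψ ((powRes I e).complex.d xs.length (xs.length - 1) y) =
          r * koszulTop xs (f xs.length (G.f xs.length y)) :=
      congrArg (fun q => q.hom y) hψ
    have h4 : r * koszulTop xs (u xs.length v) ∈ powIdeal (1 + e) xs := by
      have h5 := hψ' (g xs.length v)
      change _ = r * koszulTop xs (u xs.length v) at h5
      rw [← h5]
      exact coboundary_koszul_mem g hg ψ.hom v
    apply hprod e
    have h6 : r * xs.prod ^ e = r * koszulTop xs (u xs.length v) - r * r₂ := by
      rw [← h3]; ring
    rw [h6]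
    exact sub_mem h4 (Ideal.mul_mem_left _ _ hr₂)
  · rw [← map_smul]
    obtain ⟨ψ, hψ⟩ := exists_coboundary_of_mem_powIdeal f hf hr
    exact lcClass_eq_zero_of_coboundary I _ s _ ψ hψ

end Koszul

end TopLocalCohomologyElements

/-! ### Systems of parameters in Cohen–Macaulay rings are regular sequences. -/

section CohenMacaulay

open RingTheory.Sequence CategoryTheory Pointwise

variable {R : Type u} [CommRing R] [IsLocalRing R] [IsNoetherianRing R]

theorem ringKrullDim_le_length_of_maximalIdeal_le_radical {L : List R}
    (hL : ∀ x ∈ L, x ∈ maximalIdeal R) (h : maximalIdeal R ≤ (Ideal.ofList L).radical) :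
    ringKrullDim R ≤ L.length := by
  classical
  rw [← IsLocalRing.maximalIdeal_height_eq_ringKrullDim]
  have hmin : maximalIdeal R ∈ (Ideal.span (L.toFinset : Set R)).minimalPrimes := by
    have hs : Ideal.span (L.toFinset : Set R) = Ideal.ofList L := by
      simp [Ideal.ofList]
    rw [hs]
    refine ⟨⟨inferInstance, Ideal.span_le.mpr hL⟩, fun q hq hqm => ?_⟩
    exact h.trans (hq.1.radical_le_iff.mpr hq.2)
  have h1 := Ideal.height_le_card_of_mem_minimalPrimes_span_finset hmin
  have h2 : (maximalIdeal R).height ≤ (L.length : ℕ∞) :=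
    h1.trans (by exact_mod_cast L.toFinset_card_le)
  exact_mod_cast h2

theorem ringKrullDim_quotient_le_length {p : Ideal R} [p.IsPrime] {L : List R}
    (hL : ∀ x ∈ L, x ∈ maximalIdeal R) (h : maximalIdeal R ≤ (p ⊔ Ideal.ofList L).radical) :
    ringKrullDim (R ⧸ p) ≤ L.length := by
  have : IsLocalRing (R ⧸ p) :=
    IsLocalRing.of_surjective' (Ideal.Quotient.mk p) Ideal.Quotient.mk_surjective
  have hmem (a : R) : Ideal.Quotient.mk p a ∈ maximalIdeal (R ⧸ p) ↔ a ∈ maximalIdeal R := by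
    have := IsLocalHom.of_surjective (Ideal.Quotient.mk p) Ideal.Quotient.mk_surjective
    rw [← Ideal.mem_comap, IsLocalRing.maximalIdeal_comap]
  rw [← L.length_map (f := Ideal.Quotient.mk p)]
  refine ringKrullDim_le_length_of_maximalIdeal_le_radical ?_ ?_
  · intro x hx
    obtain ⟨y, hy, rfl⟩ := List.mem_map.mp hx
    exact (hmem y).mpr (hL y hy)
  · intro b hb
    obtain ⟨a, rfl⟩ := Ideal.Quotient.mk_surjective b
    obtain ⟨k, hk⟩ := h ((hmem a).mp hb)
    refine ⟨k, ?_⟩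
    rw [← map_pow, ← Ideal.map_ofList]
    have := Ideal.mem_map_of_mem (Ideal.Quotient.mk p) hk
    rwa [Ideal.map_sup, Ideal.map_quotient_self, bot_sup_eq] at this

section Modules

variable {M : Type u} [AddCommGroup M] [Module R M] [Module.Finite R M]

/-- The depth of a module is at most the dimension of the quotients by its associated primes. -/
theorem length_le_ringKrullDim_quotient (rs : List R) (hrs : ∀ r ∈ rs, r ∈ maximalIdeal R)
    (hreg : IsWeaklyRegular M rs) (p : Ideal R) (hp : p ∈ associatedPrimes R M) :
    (rs.length : WithBot ℕ∞) ≤ ringKrullDim (R ⧸ p) := by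
  induction rs generalizing M p with
  | nil =>
    have : Nontrivial (R ⧸ p) := Ideal.Quotient.nontrivial_iff.mpr hp.1.ne_top
    simpa using ringKrullDim_nonneg_of_nontrivial
  | cons y rs ih =>
    rw [isWeaklyRegular_cons_iff] at hreg
    have hym : y ∈ maximalIdeal R := hrs y (by simp)
    have hp' := hp
    rw [AssociatedPrimes.mem_iff, isAssociatedPrime_iff] at hp'
    obtain ⟨hpp, m, hm⟩ := hp'
    have hm0 : m ≠ 0 := by
      rintro rfl
      exact hpp.ne_top (by rw [hm]; simp)
    let N : Submodule R M := Submodule.torsionBySet R M p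
    have hmN : m ∈ N := by
      rw [Submodule.mem_torsionBySet_iff]
      rintro ⟨a, ha⟩
      have : a ∈ (⊥ : Submodule R M).colon {m} := hm ▸ ha
      simpa using this
    -- If all elements killed by p lay in yM, regularity of y would give N = yN, and Nakayama would
    -- force N = 0 although it contains m.
    obtain ⟨z, hzN, hz⟩ : ∃ z ∈ N, z ∉ y • (⊤ : Submodule R M) := by
      by_contra! hcon
      refine hm0 ?_
      have hN : N = ⊥ := by
        refine Submodule.eq_bot_of_le_smul_of_le_jacobson_bot (Ideal.span {y}) N
          (IsNoetherian.noetherian N) ?_ ?_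
        · intro z hz
          obtain ⟨w, -, rfl⟩ := hcon z hz
          refine Submodule.smul_mem_smul (Ideal.mem_span_singleton_self y) ?_
          rw [Submodule.mem_torsionBySet_iff] at hz ⊢
          rintro a
          refine hreg.1 ?_
          change y • (a : R) • w = y • (0 : M)
          rw [smul_zero, smul_comm]
          exact hz a
        · rw [Ideal.span_le, Set.singleton_subset_iff]
          exact IsLocalRing.maximalIdeal_le_jacobson _ hym
      rw [hN] at hmN
      simpa using hmN
    let z' : QuotSMulTop y M := Submodule.Quotient.mk z
    have hz' : z' ≠ 0 := fun h => hz ((Submodule.Quotient.mk_eq_zero _).mp h)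
    -- This associated prime of M/yM contains p and y, while y is not in p; hence dim R/q is at most
    -- dim R/p - 1.
    obtain ⟨q, hq, hle⟩ := exists_le_isAssociatedPrime_of_isNoetherianRing R z' hz'
    have hpq : p ≤ q := by
      refine le_trans ?_ hle
      intro a ha
      rw [Submodule.mem_colon_singleton]
      rw [Submodule.mem_torsionBySet_iff] at hzN
      have := hzN ⟨a, ha⟩
      change Submodule.Quotient.mk (a • z) = (0 : QuotSMulTop y M)
      rw [show a • z = 0 from this, Submodule.Quotient.mk_zero]
    have hyq : y ∈ q := by
      refine hle ?_
      rw [Submodule.mem_colon_singleton]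
      exact (Submodule.Quotient.mk_eq_zero _).mpr (Submodule.smul_mem_pointwise_smul _ _ _ trivial)
    have hyp : y ∉ p := by
      intro hy
      rw [hm, Submodule.mem_colon_singleton] at hy
      exact hm0 (hreg.1 (by simpa using hy))
    have h1 := ih (M := QuotSMulTop y M) (fun r hr => hrs r (by simp [hr])) hreg.2 q hq
    have h2 : ringKrullDim (R ⧸ q) ≤
        ringKrullDim ((R ⧸ p) ⧸ Ideal.span {Ideal.Quotient.mk p y}) := by
      refine ringKrullDim_le_of_surjective (Ideal.Quotient.lift _ (Ideal.Quotient.factor hpq) ?_) ?_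
      · intro a ha
        obtain ⟨b, rfl⟩ := Ideal.mem_span_singleton'.mp ha
        rw [map_mul]
        have : Ideal.Quotient.factor hpq (Ideal.Quotient.mk p y) = 0 :=
          Ideal.Quotient.eq_zero_iff_mem.mpr hyq
        rw [this, mul_zero]
      · exact Ideal.Quotient.lift_surjective_of_surjective _ _ (Ideal.Quotient.factor_surjective hpq)
    have h3 := ringKrullDim_quotient_succ_le_of_nonZeroDivisor (R := R ⧸ p)
      (r := Ideal.Quotient.mk p y) (mem_nonZeroDivisors_of_ne_zero fun h =>
        hyp (Ideal.Quotient.eq_zero_iff_mem.mp h))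
    rw [List.length_cons]
    push_cast
    exact le_trans (add_le_add_left (h1.trans h2) 1) h3

/-- A zero divisor x lies in an associated prime p of M. Then `L` alone generates an ideal of R/p
primary to its maximal ideal, so dim R/p is at most the length of `L`, against the depth bound. -/
theorem isSMulRegular_of_maximalIdeal_le_radical {x : R} {L : List R}
    (hL : ∀ y ∈ x :: L, y ∈ maximalIdeal R)
    (hrad : maximalIdeal R ≤ (Module.annihilator R M ⊔ Ideal.ofList (x :: L)).radical)
    {rs : List R} (hlen : rs.length = L.length + 1) (hrs : ∀ r ∈ rs, r ∈ maximalIdeal R)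
    (hreg : IsWeaklyRegular M rs) : IsSMulRegular M x := by
  by_contra hx
  have hmem : x ∈ ⋃ p ∈ associatedPrimes R M, (p : Set R) := by
    rw [biUnion_associatedPrimes_eq_compl_regular]
    exact hx
  simp only [Set.mem_iUnion] at hmem
  obtain ⟨p, hp, hxp⟩ := hmem
  have := hp.isPrime
  have h1 := length_le_ringKrullDim_quotient rs hrs hreg p hp
  have h2 : ringKrullDim (R ⧸ p) ≤ L.length := by
    refine ringKrullDim_quotient_le_length (fun y hy => hL y (by simp [hy])) (hrad.trans ?_)
    refine Ideal.radical_mono (sup_le (le_sup_of_le_left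
      (Submodule.annihilator_top.ge.trans hp.annihilator_le)) ?_)
    rw [Ideal.ofList_cons]
    exact sup_le_sup_right ((Ideal.span_singleton_le_iff_mem p).mpr hxp) _
  have h3 := h1.trans h2
  rw [hlen] at h3
  have h4 : L.length + 1 ≤ L.length := by exact_mod_cast h3
  omega

omit [IsNoetherianRing R] in
theorem maximalIdeal_smul_top_lt_top [Nontrivial M] :
    maximalIdeal R • (⊤ : Submodule R M) < ⊤ :=
  lt_top_iff_ne_top.mpr (Submodule.top_ne_ideal_smul_of_le_jacobson_annihilator
    (IsLocalRing.maximalIdeal_le_jacobson _)).symm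

/-- The given regular sequence need not begin with x. Depth is therefore read off from the vanishing
of Ext, which passes to M/xM through the long exact sequence of multiplication by x. -/
theorem exists_isRegular_quotSMulTop [Nontrivial M] {x : R} (hxm : x ∈ maximalIdeal R)
    (hx : IsSMulRegular M x) {n : ℕ}
    (h : ∃ rs : List R, rs.length = n + 1 ∧ (∀ r ∈ rs, r ∈ maximalIdeal R) ∧ IsRegular M rs) :
    ∃ rs : List R, rs.length = n ∧ (∀ r ∈ rs, r ∈ maximalIdeal R) ∧
      IsRegular (QuotSMulTop x M) rs := by
  have : Nontrivial (QuotSMulTop x M) := by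
    have h1 := maximalIdeal_smul_top_lt_top (R := R) (M := M)
    refine Submodule.Quotient.nontrivial_iff.mpr (ne_of_lt (lt_of_le_of_lt ?_ h1))
    rintro _ ⟨w, -, rfl⟩
    exact Submodule.smul_mem_smul hxm trivial
  have h1 := ((ModuleCat.exists_isRegular_tfae (maximalIdeal R) (n + 1) (ModuleCat.of R M)
    maximalIdeal_smul_top_lt_top).out 3 1).mp h
  refine ((ModuleCat.exists_isRegular_tfae (maximalIdeal R) n
    (ModuleCat.of R (QuotSMulTop x M)) maximalIdeal_smul_top_lt_top).out 1 3).mp fun i hi => ?_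
  have zero1 := AddCommGrpCat.isZero_of_iff_subsingleton.mpr (h1 i (by omega))
  have zero2 := AddCommGrpCat.isZero_of_iff_subsingleton.mpr (h1 (i + 1) (by omega))
  exact AddCommGrpCat.subsingleton_of_isZero <| ShortComplex.Exact.isZero_of_both_zeros
    ((Abelian.Ext.covariant_sequence_exact₃' _
      (IsSMulRegular.smulShortComplex_shortExact (M := ModuleCat.of R M) hx)) i (i + 1) rfl)
    (zero1.eq_zero_of_src _) (zero2.eq_zero_of_tgt _)

theorem isWeaklyRegular_of_maximalIdeal_le_radical [Nontrivial M] {xs : List R}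
    (hxs : ∀ x ∈ xs, x ∈ maximalIdeal R)
    (hrad : maximalIdeal R ≤ (Module.annihilator R M ⊔ Ideal.ofList xs).radical)
    (h : ∃ rs : List R, rs.length = xs.length ∧ (∀ r ∈ rs, r ∈ maximalIdeal R) ∧
      IsRegular M rs) : IsWeaklyRegular M xs := by
  induction xs generalizing M with
  | nil => exact IsWeaklyRegular.nil R M
  | cons x L ih =>
    obtain ⟨rs, hlen, hrs, hreg⟩ := h
    have hx := isSMulRegular_of_maximalIdeal_le_radical hxs hrad hlen hrs hreg.1
    have hxm : x ∈ maximalIdeal R := hxs x (by simp)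
    obtain ⟨rs', hlen', hrs', hreg'⟩ := exists_isRegular_quotSMulTop hxm hx ⟨rs, hlen, hrs, hreg⟩
    have : Nontrivial (QuotSMulTop x M) := hreg'.nontrivial
    rw [isWeaklyRegular_cons_iff]
    refine ⟨hx, ih (fun y hy => hxs y (by simp [hy])) (hrad.trans (Ideal.radical_mono ?_))
      ⟨rs', hlen', hrs', hreg'⟩⟩
    rw [Ideal.ofList_cons, ← sup_assoc]
    refine sup_le_sup_right (sup_le ?_ ?_) _
    · exact LinearMap.annihilator_le_of_surjective (Submodule.mkQ _) (Submodule.mkQ_surjective _)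
    · rw [Ideal.span_singleton_le_iff_mem, Module.mem_annihilator]
      intro z
      obtain ⟨w, rfl⟩ := Submodule.mkQ_surjective _ z
      exact (Submodule.Quotient.mk_eq_zero _).mpr (Submodule.smul_mem_pointwise_smul _ _ _ trivial)

end Modules

omit [IsNoetherianRing R] in
theorem IsCohenMacaulay.exists_isRegular {d : ℕ} (hR : IsCohenMacaulay R)
    (hd : ringKrullDim R = d) :
    ∃ rs : List R, rs.length = d ∧ (∀ r ∈ rs, r ∈ maximalIdeal R) ∧ IsRegular R rs := by
  rw [IsCohenMacaulay, hd] at hR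
  have hdep : depth R = (d : ℕ∞) := by exact_mod_cast hR
  -- The supremum is attained since otherwise every length is at most d - 1. This bound needs d > 0;
  -- for d = 0 the empty sequence serves.
  rcases Nat.eq_zero_or_pos d with rfl | hpos
  · exact ⟨[], rfl, by simp, by simp [isRegular_iff]⟩
  by_contra! hcon
  have hle : depth R ≤ ((d - 1 : ℕ) : ℕ∞) := by
    refine iSup₂_le fun rs hrs => ?_
    by_contra! hlt
    have hlt' : d - 1 < rs.length := by exact_mod_cast hlt
    have hge : d ≤ rs.length := by omega
    have hle : (rs.length : ℕ∞) ≤ depth R :=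
      le_iSup₂ (f := fun (rs : List R) (_ : (∀ r ∈ rs, r ∈ maximalIdeal R) ∧ IsRegular R rs) =>
        (rs.length : ℕ∞)) rs hrs
    rw [hdep] at hle
    exact hcon rs (le_antisymm (by exact_mod_cast hle) hge) hrs.1 hrs.2
  rw [hdep] at hle
  have : d ≤ d - 1 := by exact_mod_cast hle
  omega

/-- In a Cohen-Macaulay local ring every system of parameters is a regular sequence. -/
theorem IsCohenMacaulay.isWeaklyRegular (hR : IsCohenMacaulay R) {xs : List R}
    (hd : ringKrullDim R = xs.length) (hxs : ∀ x ∈ xs, x ∈ maximalIdeal R)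
    (hrad : maximalIdeal R ≤ (Ideal.ofList xs).radical) : IsWeaklyRegular R xs :=
  isWeaklyRegular_of_maximalIdeal_le_radical hxs
    (hrad.trans (Ideal.radical_mono le_sup_right)) (hR.exists_isRegular hd)

end CohenMacaulay

/-! ### Systems of parameters and the exactness they give in the Cohen–Macaulay case. -/

section Parameters

open RingTheory.Sequence

variable {R : Type u} [CommRing R] [IsLocalRing R]

/-- A system of parameters of a local ring, as a list. -/
structure IsParameterSystem (xs : List R) : Prop where
  mem : ∀ x ∈ xs, x ∈ maximalIdeal R
  le_radical : maximalIdeal R ≤ (Ideal.ofList xs).radical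
  ringKrullDim_eq : ringKrullDim R = xs.length

theorem IsParameterSystem.perm {xs ys : List R} (h : IsParameterSystem xs) (hp : xs.Perm ys) :
    IsParameterSystem ys where
  mem x hx := h.mem x (hp.mem_iff.mpr hx)
  le_radical := by
    have : Ideal.ofList ys = Ideal.ofList xs := by
      simp only [Ideal.ofList, hp.mem_iff]
    exact this ▸ h.le_radical
  ringKrullDim_eq := hp.length_eq ▸ h.ringKrullDim_eq

theorem IsParameterSystem.cons_pow {x : R} {xs : List R} (h : IsParameterSystem (x :: xs))
    {n : ℕ} (hn : n ≠ 0) : IsParameterSystem (x ^ n :: xs) where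
  mem y hy := by
    rcases List.mem_cons.mp hy with rfl | hy
    · exact Ideal.pow_mem_of_mem _ (h.mem x (by simp)) n (Nat.pos_of_ne_zero hn)
    · exact h.mem y (by simp [hy])
  le_radical := by
    refine h.le_radical.trans (Ideal.radical_le_radical_iff.mpr ?_)
    rw [Ideal.ofList_cons, Ideal.ofList_cons]
    refine sup_le ?_ (le_sup_right.trans Ideal.le_radical)
    rw [Ideal.span_singleton_le_iff_mem]
    exact ⟨n, Ideal.mem_sup_left (Ideal.mem_span_singleton_self _)⟩
  ringKrullDim_eq := h.ringKrullDim_eq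

theorem IsParameterSystem.exists_pow_le_powIdeal [IsNoetherianRing R] {xs : List R}
    (h : IsParameterSystem xs) (c : ℕ) : ∃ k, maximalIdeal R ^ k ≤ powIdeal c xs := by
  have hle : Ideal.ofList xs ≤ (powIdeal c xs).radical :=
    Ideal.span_le.mpr fun x hx => ⟨c, Ideal.subset_span (List.mem_map.mpr ⟨x, hx, rfl⟩)⟩
  exact Ideal.exists_pow_le_of_le_radical_of_fg
    (h.le_radical.trans (Ideal.radical_le_radical_iff.mpr hle))
    (IsNoetherian.noetherian (maximalIdeal R))

theorem exists_isParameterSystem [IsNoetherianRing R] {d : ℕ} (hd : ringKrullDim R = d) :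
    ∃ xs : List R, xs.length = d ∧ IsParameterSystem xs := by
  obtain ⟨s, hs, hcard⟩ :=
    Ideal.exists_finset_card_eq_height_of_isNoetherianRing (maximalIdeal R)
  have hheight := IsLocalRing.maximalIdeal_height_eq_ringKrullDim (R := R)
  rw [← hcard, hd] at hheight
  have hlen : s.card = d := by exact_mod_cast hheight
  refine ⟨s.toList, by simpa using hlen, fun x hx => hs.1.2 (Ideal.subset_span (by simpa using hx)),
    ?_, by simpa [hlen] using hd⟩
  have : Ideal.ofList s.toList = Ideal.span (s : Set R) := by simp [Ideal.ofList]
  rw [this, Ideal.radical_eq_sInf]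
  refine le_sInf fun q hq => ?_
  have hqm : q ≤ maximalIdeal R := IsLocalRing.le_maximalIdeal hq.2.ne_top
  exact hs.2 ⟨hq.2, hq.1⟩ hqm

variable [IsNoetherianRing R]

theorem IsCohenMacaulay.mem_ofList_of_pow_mul_mem (hR : IsCohenMacaulay R) {x : R} {L L' : List R}
    (h : IsParameterSystem (L ++ x :: L')) (n : ℕ) {r : R} (hr : x ^ n * r ∈ Ideal.ofList L) :
    r ∈ Ideal.ofList L := by
  induction n with
  | zero => simpa using hr
  | succ n ih =>
    refine ih ?_
    have hreg := hR.isWeaklyRegular h.ringKrullDim_eq h.mem h.le_radical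
    rw [isWeaklyRegular_append_iff, isWeaklyRegular_cons_iff] at hreg
    have hx := hreg.2.1
    have key (s : R) : (Submodule.Quotient.mk s : R ⧸ (Ideal.ofList L • ⊤ : Submodule R R)) = 0 ↔
        s ∈ Ideal.ofList L := by
      rw [Submodule.Quotient.mk_eq_zero, smul_eq_mul, Ideal.mul_top]
    rw [← key]
    refine hx ?_
    change x • Submodule.Quotient.mk _ = x • (0 : R ⧸ (Ideal.ofList L • ⊤ : Submodule R R))
    rw [smul_zero, ← Submodule.Quotient.mk_smul, key, smul_eq_mul, ← mul_assoc, ← pow_succ']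
    exact hr

omit [IsLocalRing R] [IsNoetherianRing R] in
theorem powIdeal_one (xs : List R) : powIdeal 1 xs = Ideal.ofList xs := by
  simp [powIdeal]

/-- Systems of parameters remain so after permutation, hence x is regular modulo the elements after
it. The list `pre` keeps the elements already removed, so that a full system of parameters stays
available in the induction. -/
theorem IsCohenMacaulay.exactAtLevel_koszul (hR : IsCohenMacaulay R) {xs : List R}
    (h : IsParameterSystem xs) : (koszul xs).ExactAtLevel 1 := by
  suffices H : ∀ pre : List R, IsParameterSystem (pre ++ xs) → (koszul xs).ExactAtLevel 1 from
    H [] h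
  clear h
  induction xs with
  | nil => exact fun _ _ => exactAtLevel_koszul_nil 1
  | cons x xs ih =>
    intro pre h
    refine exactAtLevel_koszul_cons (ih (pre ++ [x]) (by simpa using h)) fun r hr => ?_
    rw [powIdeal_one] at hr ⊢
    exact hR.mem_ofList_of_pow_mul_mem (h.perm (List.perm_append_comm.trans List.perm_middle.symm)) 1 hr

theorem IsCohenMacaulay.mem_powIdeal_one_of_mul_prod_pow_mem (hR : IsCohenMacaulay R) {xs : List R}
    (h : IsParameterSystem xs) (e : ℕ) (r : R) (hr : r * xs.prod ^ e ∈ powIdeal (1 + e) xs) :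
    r ∈ powIdeal 1 xs := by
  -- Working modulo `pre` lets the induction move x^(1+e) into `pre`. It then yields x^e (r - s x)
  -- in the ideal of `pre ++ xs` for some s, and x^e cancels there by regularity.
  suffices H : ∀ (pre : List R) (r : R), IsParameterSystem (pre ++ xs) →
      r * xs.prod ^ e ∈ Ideal.ofList pre ⊔ powIdeal (1 + e) xs →
      r ∈ Ideal.ofList pre ⊔ powIdeal 1 xs by
    simpa using H [] r h (by simpa using hr)
  clear hr h r
  induction xs with
  | nil => intro pre r _ hr; simpa [powIdeal] using hr
  | cons x xs ih =>
    intro pre r h hr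
    have h' : IsParameterSystem ((pre ++ [x ^ (1 + e)]) ++ xs) := by
      have h1 := (h.perm List.perm_middle).cons_pow (n := 1 + e) (by omega)
      have h2 := h1.perm List.perm_middle.symm
      simpa using h2
    have h1 := ih (pre ++ [x ^ (1 + e)]) (r * x ^ e) h' (by
      rw [Ideal.ofList_append, Ideal.ofList_singleton, sup_assoc, ← powIdeal_cons]
      rw [List.prod_cons, mul_pow, ← mul_assoc] at hr
      exact hr)
    rw [powIdeal_one, Ideal.ofList_append, Ideal.ofList_singleton, sup_right_comm, sup_comm,
      ← Ideal.ofList_append, Submodule.mem_sup] at h1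
    obtain ⟨a, ha, b, hb, hab⟩ := h1
    obtain ⟨s, rfl⟩ := Ideal.mem_span_singleton'.mp ha
    have h2 : r - s * x ∈ Ideal.ofList (pre ++ xs) := by
      refine hR.mem_ofList_of_pow_mul_mem (L' := []) (h.perm ?_) e (x := x) ?_
      · exact List.perm_middle.trans (List.perm_append_singleton x (pre ++ xs)).symm
      · rw [show x ^ e * (r - s * x) = b by linear_combination -hab]
        exact hb
    rw [powIdeal_one, Ideal.ofList_cons, sup_left_comm, ← Ideal.ofList_append]
    rw [show r = s * x + (r - s * x) by ring]
    exact Submodule.add_mem_sup (Ideal.mem_span_singleton'.mpr ⟨s, rfl⟩) h2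

end Parameters

/-! ### Forms with a unit value and integral dependence. -/

section HomogeneousForms

open Polynomial

variable {R : Type u} [CommRing R] {σ : Type v} [Fintype σ] {A : Type w} [CommRing A]

omit [Fintype σ] in
theorem natDegree_prod_linear_pow_le (u v : σ → A) (e : σ → ℕ) (s : Finset σ) :
    (∏ i ∈ s, (C (u i) + C (v i) * X) ^ e i).natDegree ≤ ∑ i ∈ s, e i := by
  refine (natDegree_prod_le _ _).trans (Finset.sum_le_sum fun i _ => ?_)
  refine (natDegree_pow_le_of_le (m := 1) (e i) ?_).trans (by simp)
  compute_degree

omit [Fintype σ] in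
theorem coeff_prod_linear_pow (u v : σ → A) (e : σ → ℕ) (s : Finset σ) :
    (∏ i ∈ s, (C (u i) + C (v i) * X) ^ e i).coeff (∑ i ∈ s, e i) = ∏ i ∈ s, v i ^ e i := by
  classical
  induction s using Finset.induction_on with
  | empty => simp
  | insert a s ha ih =>
    have hlin : (C (u a) + C (v a) * X).natDegree ≤ 1 := by compute_degree
    rw [Finset.prod_insert ha, Finset.sum_insert ha, Finset.prod_insert ha,
      coeff_mul_add_eq_of_natDegree_le ((natDegree_pow_le_of_le (e a) hlin).trans (by simp))
        (natDegree_prod_linear_pow_le u v e s), ih]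
    congr 1
    have := coeff_pow_of_natDegree_le (m := e a) hlin
    rw [mul_one] at this
    simpa using this

variable [Algebra R A]

theorem natDegree_aeval_linear_le {n : ℕ} {F : MvPolynomial σ R} (hF : F.IsHomogeneous n)
    (u v : σ → A) :
    (MvPolynomial.aeval (fun i => C (u i) + C (v i) * X) F).natDegree ≤ n := by
  rw [MvPolynomial.aeval_def, MvPolynomial.eval₂_eq']
  refine natDegree_sum_le_of_forall_le _ _ fun e he => ?_
  rw [IsScalarTower.algebraMap_eq R A A[X], RingHom.comp_apply, Polynomial.algebraMap_eq]
  refine (natDegree_C_mul_le _ _).trans ((natDegree_prod_linear_pow_le u v e _).trans ?_)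
  rw [← Finsupp.degree_eq_sum]
  exact (hF.degree_eq_sum_deg_support he).ge

theorem coeff_aeval_linear {n : ℕ} {F : MvPolynomial σ R} (hF : F.IsHomogeneous n)
    (u v : σ → A) :
    (MvPolynomial.aeval (fun i => C (u i) + C (v i) * X) F).coeff n = MvPolynomial.aeval v F := by
  rw [MvPolynomial.aeval_def, MvPolynomial.eval₂_eq', MvPolynomial.aeval_def,
    MvPolynomial.eval₂_eq', finsetSum_coeff]
  refine Finset.sum_congr rfl fun e he => ?_
  rw [IsScalarTower.algebraMap_eq R A A[X], RingHom.comp_apply, Polynomial.algebraMap_eq,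
    coeff_C_mul]
  have hdeg : n = ∑ i, e i := by
    rw [← Finsupp.degree_eq_sum]
    exact hF.degree_eq_sum_deg_support he
  rw [hdeg, coeff_prod_linear_pow]

theorem aeval_mul_right_of_isHomogeneous {n : ℕ} {F : MvPolynomial σ R} (hF : F.IsHomogeneous n)
    (v : σ → A) (t : A) :
    MvPolynomial.aeval (fun i => v i * t) F = MvPolynomial.aeval v F * t ^ n := by
  simp only [MvPolynomial.aeval_def, MvPolynomial.eval₂_eq', Finset.sum_mul]
  refine Finset.sum_congr rfl fun e he => ?_
  have hdeg : ∑ i, e i = n := by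
    rw [← Finsupp.degree_eq_sum]
    exact (hF.degree_eq_sum_deg_support he).symm
  simp only [mul_pow, Finset.prod_mul_distrib, Finset.prod_pow_eq_pow_sum, hdeg, mul_assoc]

theorem isIntegral_of_isUnit_coeff {B : Type*} [CommRing B] [Algebra A B] {P : A[X]} {n : ℕ}
    (hP : P.natDegree ≤ n) (hu : IsUnit (P.coeff n)) {z : B} (hz : aeval z P = 0) :
    IsIntegral A z := by
  obtain ⟨c, hc⟩ := hu.exists_left_inv
  refine ⟨C c * P, monic_of_natDegree_le_of_coeff_eq_one n
    ((natDegree_C_mul_le _ _).trans hP) (by rw [coeff_C_mul, hc]), ?_⟩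
  rw [← aeval_def, map_mul, hz, mul_zero]

/-- If a form with a unit value at a point `b` with `b j = 1` vanishes at `x`, then `x j` is
integral over the ideal generated by the elements `x i - b i * x j`. -/
theorem mem_icFree_of_eval_eq_zero {l n : ℕ} {F : MvPolynomial (Fin (l + 1)) R}
    (hF : F.IsHomogeneous n) {x b : Fin (l + 1) → R} (hx : MvPolynomial.eval x F = 0)
    (hb : IsUnit (MvPolynomial.eval b F)) {j : Fin (l + 1)} (hj : b j = 1) :
    x j ∈ icFree (Ideal.span (Set.range fun i => x (j.succAbove i) - b (j.succAbove i) * x j)) := by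
  set K : Ideal R := Ideal.span (Set.range fun i => x (j.succAbove i) - b (j.succAbove i) * x j)
  have hK (i : Fin (l + 1)) : x i - b i * x j ∈ K ^ 1 := by
    rw [pow_one]
    rcases eq_or_ne i j with rfl | hij
    · simp [hj]
    · obtain ⟨k, rfl⟩ := Fin.exists_succAbove_eq hij
      exact Ideal.subset_span ⟨k, rfl⟩
  rw [mem_icFree_iff_isIntegral_reesAlgebra]
  set A := reesAlgebra K
  let u (i : Fin (l + 1)) : A := ⟨monomial 1 (x i - b i * x j), reesAlgebra.monomial_mem.mpr (hK i)⟩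
  let v (i : Fin (l + 1)) : A := algebraMap R A (b i)
  have hv : MvPolynomial.aeval v F = algebraMap R A (MvPolynomial.eval b F) := by
    rw [← MvPolynomial.aeval_eq_eval]
    exact MvPolynomial.aeval_algebraMap_apply A b F
  -- F(u + vX) has top coefficient F(b), a unit. It vanishes at x_j t, with t the Rees variable,
  -- because u_i + b_i x_j t = x_i t and F(x) = 0.
  refine isIntegral_of_isUnit_coeff (natDegree_aeval_linear_le hF u v) ?_ ?_
  · rw [coeff_aeval_linear hF, hv]
    exact hb.map _
  · change ((aeval (monomial 1 (x j) : R[X]) : A[X] →ₐ[A] R[X]).restrictScalars R)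
      (MvPolynomial.aeval _ F) = 0
    rw [← AlgHom.comp_apply, MvPolynomial.comp_aeval]
    have : (fun i => ((aeval (monomial 1 (x j) : R[X]) : A[X] →ₐ[A] R[X]).restrictScalars R)
        (C (u i) + C (v i) * X)) = fun i => algebraMap R R[X] (x i) * X := by
      funext i
      have h1 : (algebraMap A R[X]) (u i) = monomial 1 (x i - b i * x j) := rfl
      have h2 : (algebraMap A R[X]) (v i) = C (b i) := rfl
      simp only [AlgHom.restrictScalars_apply, map_add, map_mul, aeval_C, aeval_X, h1, h2]
      rw [C_mul_monomial, ← map_add, sub_add_cancel, Polynomial.algebraMap_eq, C_mul_X_eq_monomial]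
    have hx' : MvPolynomial.aeval (fun i => algebraMap R R[X] (x i)) F = 0 := by
      refine (MvPolynomial.aeval_algebraMap_apply R[X] x F).trans ?_
      rw [MvPolynomial.aeval_eq_eval, hx, map_zero]
    rw [this, aeval_mul_right_of_isHomogeneous hF, hx', zero_mul]

end HomogeneousForms

/-! ### Analytic independence of minimal reductions. -/

section Independence

open MvPolynomial

variable {R : Type u} [CommRing R] [IsLocalRing R]

/-- Over an infinite residue field the nonzero reduction of F has a point a with nonzero value.
Scaling a lift of a so that one coordinate becomes 1 makes x_j integral over the differences x_i -
b_i x_j, which are one fewer in number. -/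
theorem exists_reduction_of_eval_eq_zero [Infinite (ResidueField R)] {l n : ℕ}
    {F : MvPolynomial (Fin l) R} (hF : F.IsHomogeneous n) {x : Fin l → R} (hx : eval x F = 0)
    {e : Fin l →₀ ℕ} (he : coeff e F ∉ maximalIdeal R) :
    ∃ l' < l, ∃ y : Fin l' → R, Ideal.span (Set.range y) ≤ Ideal.span (Set.range x) ∧
      Ideal.span (Set.range x) ≤ icFree (Ideal.span (Set.range y)) := by
  have hne : map (residue R) F ≠ 0 := by
    intro h0
    have := congrArg (coeff e) h0
    rw [coeff_map, coeff_zero, residue_eq_zero_iff] at this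
    exact he this
  obtain ⟨a, ha⟩ : ∃ a, eval a (map (residue R) F) ≠ 0 := by
    by_contra! hcon
    exact hne (MvPolynomial.funext fun a => by rw [hcon a, map_zero])
  have hscale (t : ResidueField R) :
      eval (fun i => a i * t) (map (residue R) F) = eval a (map (residue R) F) * t ^ n := by
    simpa [aeval_eq_eval] using aeval_mul_right_of_isHomogeneous (hF.map (residue R)) a t
  -- A nonzero value at the origin would force n = 0, so F would be a constant; as F vanishes at x,
  -- it would be zero.
  obtain ⟨j, hj⟩ : ∃ j, a j ≠ 0 := by
    by_contra! hcon
    have hn : n = 0 := by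
      by_contra hn
      have h1 := hscale 0
      rw [zero_pow hn, mul_zero] at h1
      refine ha ?_
      rw [← h1]
      congr 1
      congr 1
      funext i
      simp [hcon i]
    subst hn
    rw [← totalDegree_zero_iff_isHomogeneous, totalDegree_eq_zero_iff_eq_C] at hF
    rw [hF, eval_C] at hx
    rw [hx, C_0] at hF
    exact hne (by rw [hF, map_zero])
  obtain ⟨l, rfl⟩ : ∃ l', l = l' + 1 := ⟨l - 1, by have := j.pos; omega⟩
  choose b₀ hb₀ using fun i => residue_surjective (a i)
  have hunit : IsUnit (b₀ j) := by
    rw [← residue_ne_zero_iff_isUnit, hb₀]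
    exact hj
  obtain ⟨c, hc⟩ := hunit.exists_right_inv
  set b : Fin (l + 1) → R := fun i => b₀ i * c
  have hbu : IsUnit (eval b F) := by
    rw [← residue_ne_zero_iff_isUnit, eval₂_comp, eval₂_eq_eval_map]
    have : (residue R) ∘ b = fun i => a i * residue R c := by
      funext i
      simp [b, hb₀]
    rw [this, hscale]
    refine mul_ne_zero ha (pow_ne_zero _ ?_)
    rw [residue_ne_zero_iff_isUnit]
    exact IsUnit.of_mul_eq_one_right _ hc
  have key := mem_icFree_of_eval_eq_zero hF hx hbu (j := j) hc
  refine ⟨l, Nat.lt_succ_self l, fun i => x (j.succAbove i) - b (j.succAbove i) * x j, ?_, ?_⟩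
  swap
  · rw [Ideal.span_le]
    rintro _ ⟨i, rfl⟩
    rcases eq_or_ne i j with rfl | hij
    · exact key
    · obtain ⟨k, rfl⟩ := Fin.exists_succAbove_eq hij
      have h0 : x (j.succAbove k) - b (j.succAbove k) * x j ∈
          Ideal.span (Set.range fun i => x (j.succAbove i) - b (j.succAbove i) * x j) :=
        Ideal.subset_span ⟨k, rfl⟩
      have h1 := add_mem (le_icFree _ h0)
        (Submodule.smul_mem _ (b (j.succAbove k)) key)
      simpa using h1
  · rw [Ideal.span_le]
    rintro _ ⟨i, rfl⟩
    exact sub_mem (Ideal.subset_span ⟨_, rfl⟩)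
      (Ideal.mul_mem_left _ _ (Ideal.subset_span ⟨_, rfl⟩))

omit [IsLocalRing R] in
theorem exists_form_of_mem_pow_succ {l n : ℕ} {x : Fin l → R} {z : R}
    (hz : z ∈ Ideal.span (Set.range x) ^ (n + 1)) :
    ∃ G : MvPolynomial (Fin l) R, G.IsHomogeneous n ∧
      (∀ e, coeff e G ∈ Ideal.span (Set.range x)) ∧ eval x G = z := by
  rw [pow_succ'] at hz
  refine Submodule.mul_induction_on hz ?_ ?_
  · intro a ha b hb
    obtain ⟨H, hH, rfl⟩ := (Ideal.mem_span_pow_iff_exists_isHomogeneous x b).mp hb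
    exact ⟨C a * H, hH.C_mul a, fun e => by rw [coeff_C_mul]; exact Ideal.mul_mem_right _ _ ha,
      by simp⟩
  · rintro _ _ ⟨G, hG, hGc, rfl⟩ ⟨H, hH, hHc, rfl⟩
    exact ⟨G + H, hG.add hH, fun e => by rw [coeff_add]; exact add_mem (hGc e) (hHc e), by simp⟩

/-- Minimal reductions are analytically independent. -/
theorem coeff_mem_maximalIdeal_of_eval_mem_pow_succ [Infinite (ResidueField R)] {l n : ℕ}
    {x : Fin l → R} (hxm : ∀ i, x i ∈ maximalIdeal R)
    (hmin : ∀ l' < l, ∀ y : Fin l' → R, Ideal.span (Set.range y) ≤ Ideal.span (Set.range x) →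
      ¬ Ideal.span (Set.range x) ≤ icFree (Ideal.span (Set.range y)))
    {F : MvPolynomial (Fin l) R} (hF : F.IsHomogeneous n)
    (hx : eval x F ∈ Ideal.span (Set.range x) ^ (n + 1)) (e : Fin l →₀ ℕ) :
    coeff e F ∈ maximalIdeal R := by
  by_contra he
  -- G has degree n and coefficients in J ⊆ m, so F - G vanishes at x and still has a unit
  -- coefficient. This produces a reduction with fewer generators.
  obtain ⟨G, hG, hGc, hGx⟩ := exists_form_of_mem_pow_succ hx
  have hJ : Ideal.span (Set.range x) ≤ maximalIdeal R :=
    Ideal.span_le.mpr (by rintro _ ⟨i, rfl⟩; exact hxm i)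
  obtain ⟨l', hl', y, hy, hy'⟩ := exists_reduction_of_eval_eq_zero (hF.sub hG)
    (x := x) (by simp [hGx]) (e := e) (by
      rw [coeff_sub]
      intro h
      exact he ((Submodule.sub_mem_iff_left _ (hJ (hGc e))).mp h))
  exact hmin l' hl' y hy hy'

/-- The coheight of an ideal is the length of its quotient. Adjoining to J^N the monomials in x of
degree below N, in order of decreasing degree, gives a chain that is strict by analytic
independence. -/
theorem card_le_coheight_span_pow [Infinite (ResidueField R)] {l N : ℕ}
    {x : Fin l → R} (hxm : ∀ i, x i ∈ maximalIdeal R)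
    (hmin : ∀ l' < l, ∀ y : Fin l' → R, Ideal.span (Set.range y) ≤ Ideal.span (Set.range x) →
      ¬ Ideal.span (Set.range x) ≤ icFree (Ideal.span (Set.range y)))
    (S : Finset (Fin l →₀ ℕ)) (hS : ∀ e ∈ S, e.degree < N) :
    (S.card : ℕ∞) ≤ Order.coheight (Ideal.span (Set.range x) ^ N) := by
  classical
  set J := Ideal.span (Set.range x)
  have hmono (e : Fin l →₀ ℕ) (r : R) : eval x (monomial e r) ∈ J ^ e.degree :=
    (Ideal.mem_span_pow_iff_exists_isHomogeneous x _).mpr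
      ⟨_, isHomogeneous_monomial r rfl, rfl⟩
  suffices H : (S.card : ℕ∞) + Order.coheight
      (Ideal.span ((fun e => eval x (monomial e (1 : R))) '' (S : Set (Fin l →₀ ℕ))) ⊔ J ^ N) ≤
      Order.coheight (J ^ N) from le_trans le_self_add H
  induction S using Finset.induction_on_min_value (fun e : Fin l →₀ ℕ => e.degree) with
  | empty => simp
  | insert a s ha hle ih =>
    specialize ih fun e he => hS e (Finset.mem_insert_of_mem he)
    refine le_trans ?_ ih
    set K := Ideal.span ((fun e => eval x (monomial e (1 : R))) '' (s : Set (Fin l →₀ ℕ))) ⊔ J ^ N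
    rw [Finset.card_insert_of_notMem ha, Nat.cast_add, add_assoc]
    gcongr
    rw [Nat.cast_one, add_comm]
    refine Order.coheight_add_one_le (lt_of_le_of_ne ?_ fun heq => ?_)
    · exact sup_le_sup_right (Ideal.span_mono (by gcongr; simp)) _
    have hmem : eval x (monomial a (1 : R)) ∈ K := by
      rw [heq]
      exact Ideal.mem_sup_left (Ideal.subset_span ⟨a, by simp, rfl⟩)
    set n := a.degree
    -- Modulo J^(n+1), `K` consists of values of degree n forms without the monomial `a`, since the
    -- members of `s` have degree at least n and n < N. If x^a lay in `K`, this would give a form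
    -- with coefficient 1 at `a` and value in J^(n+1).
    have hK (u : R) (hu : u ∈ K) : ∃ F : MvPolynomial (Fin l) R, F.IsHomogeneous n ∧
        coeff a F = 0 ∧ u - eval x F ∈ J ^ (n + 1) := by
      let T : Ideal R :=
        { carrier := {u | ∃ F : MvPolynomial (Fin l) R, F.IsHomogeneous n ∧
            coeff a F = 0 ∧ u - eval x F ∈ J ^ (n + 1)}
          add_mem' := by
            rintro u v ⟨F, hF, hFa, hu⟩ ⟨G, hG, hGa, hv⟩
            refine ⟨F + G, hF.add hG, by rw [coeff_add, hFa, hGa, add_zero], ?_⟩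
            rw [map_add, add_sub_add_comm]
            exact add_mem hu hv
          zero_mem' := ⟨0, isHomogeneous_zero _ _ _, coeff_zero _, by simp⟩
          smul_mem' := by
            rintro r u ⟨F, hF, hFa, hu⟩
            refine ⟨C r * F, hF.C_mul r, by rw [coeff_C_mul, hFa, mul_zero], ?_⟩
            rw [map_mul, eval_C, smul_eq_mul, ← mul_sub]
            exact Ideal.mul_mem_left _ _ hu }
      have hKT : K ≤ T := by
        refine sup_le (Ideal.span_le.mpr ?_) fun u hu => ?_
        · rintro _ ⟨e, he, rfl⟩
          rcases (hle e he).eq_or_lt with hdeg | hdeg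
          · refine ⟨monomial e 1, isHomogeneous_monomial 1 hdeg.symm, ?_, by simp⟩
            rw [coeff_monomial, if_neg]
            rintro rfl
            exact ha he
          · refine ⟨0, isHomogeneous_zero _ _ _, coeff_zero _, ?_⟩
            rw [map_zero, sub_zero]
            exact Ideal.pow_le_pow_right hdeg (hmono e 1)
        · refine ⟨0, isHomogeneous_zero _ _ _, coeff_zero _, ?_⟩
          rw [map_zero, sub_zero]
          exact Ideal.pow_le_pow_right (hS a (Finset.mem_insert_self a s)) hu
      exact hKT hu
    obtain ⟨F, hF, hFa, hu⟩ := hK _ hmem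
    have := coeff_mem_maximalIdeal_of_eval_mem_pow_succ hxm hmin
      ((isHomogeneous_monomial (d := a) (1 : R) rfl).sub hF) (by rw [map_sub]; exact hu) a
    rw [coeff_sub, hFa, sub_zero, coeff_monomial, if_pos rfl] at this
    exact (Ideal.ne_top_iff_one _).mp (maximalIdeal.isMaximal R).ne_top this

end Independence

/-! ### Length bounds modulo powers of parameters. -/

section Length

variable {R : Type u} [CommRing R]

theorem length_le_add_of_exact {M N P : Type*} [AddCommGroup M] [Module R M] [AddCommGroup N]
    [Module R N] [AddCommGroup P] [Module R P] (f : M →ₗ[R] N) (g : N →ₗ[R] P)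
    (hfg : Function.Exact f g) (hg : Function.Surjective g) :
    Module.length R N ≤ Module.length R M + Module.length R P := by
  rw [Module.length_eq_add_of_exact (LinearMap.range f).subtype g
    (LinearMap.range f).injective_subtype hg
    (LinearMap.exact_iff.mpr (by rw [Submodule.range_subtype, hfg.linearMap_ker_eq]))]
  gcongr
  exact Module.length_le_of_surjective f.rangeRestrict f.surjective_rangeRestrict

/-- Multiplication by x^c gives an exact sequence R/(I, x) → R/(I, x^(c+1)) → R/(I, x^c) → 0, so
each power adds at most one copy of the length of R/(I, x). -/
theorem coheight_sup_span_pow_le (I : Ideal R) (x : R) (c : ℕ) :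
    Order.coheight (I ⊔ Ideal.span {x ^ c}) ≤ c * Order.coheight (I ⊔ Ideal.span {x}) := by
  induction c with
  | zero =>
    have : I ⊔ Ideal.span {x ^ 0} = ⊤ := by simp
    rw [this]
    simp
  | succ c ih =>
    have hf : I ⊔ Ideal.span {x} ≤
        Submodule.comap (LinearMap.mulLeft R (x ^ c)) (I ⊔ Ideal.span {x ^ (c + 1)}) := by
      refine sup_le (fun a ha => ?_) ((Ideal.span_singleton_le_iff_mem _).mpr ?_)
      · exact Ideal.mem_sup_left (Ideal.mul_mem_left _ _ ha)
      · exact Ideal.mem_sup_right (Ideal.mem_span_singleton'.mpr ⟨1, by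
          rw [one_mul, pow_succ, LinearMap.mulLeft_apply]⟩)
    have hg : I ⊔ Ideal.span {x ^ (c + 1)} ≤ I ⊔ Ideal.span {x ^ c} :=
      sup_le_sup_left (Ideal.span_singleton_le_span_singleton.mpr (pow_dvd_pow x c.le_succ)) _
    have h1 := length_le_add_of_exact (Submodule.mapQ _ _ (LinearMap.mulLeft R (x ^ c)) hf)
      (Submodule.factor hg) (fun z => ?_) (Submodule.factor_surjective hg)
    · simp only [Module.length_quotient] at h1
      calc _ ≤ _ := h1
        _ ≤ Order.coheight (I ⊔ Ideal.span {x}) + c * Order.coheight (I ⊔ Ideal.span {x}) := by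
          gcongr
        _ = _ := by push_cast; ring
    · obtain ⟨a, rfl⟩ := Submodule.mkQ_surjective _ z
      constructor
      · intro ha
        have ha' : a ∈ I ⊔ Ideal.span {x ^ c} := (Submodule.Quotient.mk_eq_zero _).mp ha
        obtain ⟨i, hi, b, hb, rfl⟩ := Submodule.mem_sup.mp ha'
        obtain ⟨t, rfl⟩ := Ideal.mem_span_singleton'.mp hb
        refine ⟨Submodule.Quotient.mk t, ?_⟩
        refine (Submodule.Quotient.eq _).mpr ?_
        rw [LinearMap.mulLeft_apply, show x ^ c * t - (i + t * x ^ c) = -i by ring]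
        exact Ideal.mem_sup_left (neg_mem hi)
      · rintro ⟨w, hw⟩
        obtain ⟨t, rfl⟩ := Submodule.mkQ_surjective _ w
        rw [← hw]
        refine (Submodule.Quotient.mk_eq_zero _).mpr ?_
        exact Ideal.mem_sup_right (Ideal.mem_span_singleton'.mpr ⟨t, mul_comm _ _⟩)

theorem coheight_sup_powIdeal_le (c : ℕ) (xs : List R) (I : Ideal R) :
    Order.coheight (I ⊔ powIdeal c xs) ≤
      (c : ℕ∞) ^ xs.length * Order.coheight (I ⊔ powIdeal 1 xs) := by
  induction xs generalizing I with
  | nil => simp [powIdeal]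
  | cons x xs ih =>
    calc Order.coheight (I ⊔ powIdeal c (x :: xs))
        = Order.coheight ((I ⊔ powIdeal c xs) ⊔ Ideal.span {x ^ c}) := by
          rw [powIdeal_cons, sup_comm (Ideal.span {x ^ c}), sup_assoc]
      _ ≤ c * Order.coheight ((I ⊔ Ideal.span {x}) ⊔ powIdeal c xs) := by
          rw [sup_right_comm I (Ideal.span {x})]
          exact coheight_sup_span_pow_le (I ⊔ powIdeal c xs) x c
      _ ≤ c * (c ^ xs.length * Order.coheight ((I ⊔ Ideal.span {x}) ⊔ powIdeal 1 xs)) := by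
          gcongr
          exact ih _
      _ = (c : ℕ∞) ^ (x :: xs).length * Order.coheight (I ⊔ powIdeal 1 (x :: xs)) := by
          rw [powIdeal_cons, pow_one, sup_assoc, List.length_cons, pow_succ', mul_assoc]

theorem coheight_ne_top_of_maximalIdeal_le_radical [IsLocalRing R] [IsNoetherianRing R]
    {I : Ideal R} (hI : I ≤ maximalIdeal R) (hm : maximalIdeal R ≤ I.radical) :
    Order.coheight I ≠ ⊤ := by
  have hmin : maximalIdeal R ∈ I.minimalPrimes :=
    ⟨⟨inferInstance, hI⟩, fun q hq _ => hm.trans (hq.1.radical_le_iff.mpr hq.2)⟩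
  have := IsLocalRing.quotient_artinian_of_mem_minimalPrimes_of_isLocalRing I hmin
  rw [← Module.length_quotient,
    Module.length_eq_of_surjective (S := R) (R := R ⧸ I) Ideal.Quotient.mk_surjective]
  exact Module.length_ne_top

end Length

/-! ### Reductions of m-primary ideals generated by systems of parameters. -/

section Reduction

variable {R : Type u} [CommRing R] [IsLocalRing R]

omit [IsLocalRing R] in
theorem le_radical_of_le_icFree {I J : Ideal R} (h : I ≤ icFree J) : I ≤ J.radical := by
  intro z hz
  obtain ⟨n, a, hn, ha, heq⟩ := (mem_icFree_iff_mem_idealClosure J z).mp (h hz)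
  refine ⟨n, ?_⟩
  rw [eq_neg_of_add_eq_zero_left heq]
  refine neg_mem (sum_mem fun i hi => Ideal.mul_mem_right _ _ ?_)
  exact Ideal.pow_le_self (by have := (Finset.mem_Icc.mp hi).1; omega) (ha i hi)

theorem exists_pow_gt_mul_pow {d l : ℕ} (h : d < l) (a C : ℕ) :
    ∃ q : ℕ, (a * (l * q + 1)) ^ d * C < q ^ l := by
  -- For q ≥ 1, lq + 1 ≤ (l + 1)q bounds the left side by a constant times q^d; q is taken one
  -- larger than that constant.
  refine ⟨(a * (l + 1)) ^ d * C + 1, ?_⟩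
  obtain ⟨q, hq⟩ : ∃ q, q = (a * (l + 1)) ^ d * C + 1 := ⟨_, rfl⟩
  rw [← hq]
  calc (a * (l * q + 1)) ^ d * C ≤ (a * ((l + 1) * q)) ^ d * C := by
        gcongr
        rw [add_mul, one_mul]
        omega
    _ = (a * (l + 1)) ^ d * C * q ^ d := by rw [← mul_assoc, mul_pow _ q]; ring
    _ < q * q ^ d := by
        refine Nat.mul_lt_mul_of_pos_right ?_ (pow_pos ?_ d) <;> omega
    _ = q ^ (d + 1) := by ring
    _ ≤ q ^ l := Nat.pow_le_pow_right (by omega) h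

variable [IsNoetherianRing R] [Infinite (ResidueField R)]

/-- The number of generators of a minimal reduction is at most the dimension. -/
theorem le_of_forall_not_le_icFree {d l : ℕ} (hd : ringKrullDim R = d) {x : Fin l → R}
    (hxm : ∀ i, x i ∈ maximalIdeal R)
    (hrad : maximalIdeal R ≤ (Ideal.span (Set.range x)).radical)
    (hmin : ∀ l' < l, ∀ y : Fin l' → R, Ideal.span (Set.range y) ≤ Ideal.span (Set.range x) →
      ¬ Ideal.span (Set.range x) ≤ icFree (Ideal.span (Set.range y))) : l ≤ d := by
  classical
  by_contra! hlt
  set J := Ideal.span (Set.range x)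
  obtain ⟨k, hk⟩ := Ideal.exists_pow_le_of_le_radical_of_fg hrad
    (IsNoetherian.noetherian (maximalIdeal R))
  obtain ⟨ys, hlen, hys⟩ := exists_isParameterSystem hd
  have hfin : Order.coheight (powIdeal 1 ys) ≠ ⊤ := by
    rw [powIdeal_one]
    exact coheight_ne_top_of_maximalIdeal_le_radical (Ideal.span_le.mpr hys.mem) hys.le_radical
  obtain ⟨C, hC⟩ := ENat.ne_top_iff_exists.mp hfin
  -- The q^l monomials with all exponents below q have degree less than N = lq + 1, so R/J^N has
  -- length at least q^l. As the (kN)-th powers of the parameters lie in m^(kN) ⊆ J^N, the length is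
  -- also at most (kN)^d C. For l > d this fails at the chosen q.
  obtain ⟨q, hq⟩ := exists_pow_gt_mul_pow hlt k C
  set N := l * q + 1
  let S : Finset (Fin l →₀ ℕ) := (Fintype.piFinset fun _ : Fin l => Finset.range q).map
    Finsupp.equivFunOnFinite.symm.toEmbedding
  have hScard : S.card = q ^ l := by simp [S]
  have hS : ∀ e ∈ S, e.degree < N := by
    intro e he
    obtain ⟨f, hf, rfl⟩ := Finset.mem_map.mp he
    rw [Finsupp.degree_eq_sum]
    refine Nat.lt_succ_of_le ((Finset.sum_le_card_nsmul _ _ q fun i _ => ?_).trans (by simp))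
    exact (Finset.mem_range.mp (Fintype.mem_piFinset.mp hf i)).le
  have h1 := card_le_coheight_span_pow hxm hmin S hS
  have hle : powIdeal (k * N) ys ≤ J ^ N :=
    (powIdeal_le_pow hys.mem _).trans (by rw [pow_mul]; exact Ideal.pow_right_mono hk N)
  have h2 := h1.trans (Order.coheight_anti hle)
  have h3 := coheight_sup_powIdeal_le (k * N) ys ⊥
  rw [bot_sup_eq, bot_sup_eq, ← hC, hlen] at h3
  have h4 := h2.trans h3
  rw [hScard] at h4
  have h5 : q ^ l ≤ (k * N) ^ d * C := by exact_mod_cast h4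
  omega

/-- A reduction of I with the least number of generators has no reduction with fewer, by
transitivity of integral closure, so `le_of_forall_not_le_icFree` bounds that number by d. -/
theorem exists_isParameterSystem_le_icFree {d : ℕ} (hd : ringKrullDim R = d) {I : Ideal R}
    (hI : I ≤ maximalIdeal R) (hrad : maximalIdeal R ≤ I.radical) :
    ∃ xs : List R, xs.length = d ∧ IsParameterSystem xs ∧ Ideal.ofList xs ≤ I ∧
      I ≤ icFree (Ideal.ofList xs) := by
  classical
  have hex : ∃ l, ∃ x : Fin l → R, Ideal.span (Set.range x) ≤ I ∧
      I ≤ icFree (Ideal.span (Set.range x)) := by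
    obtain ⟨l, x, hx⟩ := Submodule.fg_iff_exists_fin_generating_family.mp
      (IsNoetherian.noetherian I)
    exact ⟨l, x, hx.le, hx.ge.trans (le_icFree _)⟩
  obtain ⟨l, hl⟩ : ∃ l, l = Nat.find hex := ⟨_, rfl⟩
  obtain ⟨x, hxI, hIx⟩ := hl ▸ Nat.find_spec hex
  have hradJ : maximalIdeal R ≤ (Ideal.span (Set.range x)).radical :=
    hrad.trans (Ideal.radical_le_radical_iff.mpr (le_radical_of_le_icFree hIx))
  have hld : l ≤ d := by
    refine le_of_forall_not_le_icFree hd (fun i => hI (hxI (Ideal.subset_span ⟨i, rfl⟩))) hradJ ?_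
    intro l' hl' y hy hxy
    exact Nat.find_min hex (hl ▸ hl') ⟨y, hy.trans hxI, hIx.trans (icFree_le_icFree_of_le hxy)⟩
  -- Padding with zeros brings the length to exactly d without changing the ideal.
  let xs := List.ofFn x ++ List.replicate (d - l) 0
  have hxs : Ideal.ofList xs = Ideal.span (Set.range x) := by
    have h0 : Ideal.ofList (List.replicate (d - l) (0 : R)) = ⊥ := by
      refine le_bot_iff.mp (Ideal.span_le.mpr fun y hy => ?_)
      exact (List.mem_replicate.mp hy).2
    rw [Ideal.ofList_append, h0, sup_bot_eq]
    simp [Ideal.ofList, Set.range, List.mem_ofFn]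
  have hlen : xs.length = d := by simp [xs]; omega
  refine ⟨xs, hlen, ⟨fun y hy => hI (hxI (hxs.le (Ideal.subset_span hy))), hxs ▸ hradJ, hlen ▸ hd⟩,
    hxs ▸ hxI, hxs ▸ hIx⟩

end Reduction

/-! ### The two inclusions. -/

section Main

variable {R : Type u} [CommRing R]

theorem mem_tauI_iff {a : R} :
    a ∈ tauI R ↔ ∀ (I : Ideal R), ∀ z ∈ idealClosure I, a * z ∈ I := by
  simp only [tauI, Submodule.mem_iInf, Submodule.mem_colon, smul_eq_mul]

theorem idealClosure_mono {I J : Ideal R} (h : I ≤ J) : idealClosure I ⊆ idealClosure J :=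
  fun _ ⟨n, a, hn, ha, heq⟩ => ⟨n, a, hn, fun i hi => Ideal.pow_right_mono h i (ha i hi), heq⟩

theorem mem_of_forall_mem_sup_pow [IsLocalRing R] [IsNoetherianRing R] {I : Ideal R} {z : R}
    (h : ∀ n, z ∈ I ⊔ maximalIdeal R ^ n) : z ∈ I := by
  rcases eq_or_ne I ⊤ with rfl | hI
  · trivial
  have hbot := Ideal.iInf_pow_smul_eq_bot_of_isLocalRing (M := R ⧸ I) (maximalIdeal R)
    (maximalIdeal.isMaximal R).ne_top
  rw [← Ideal.Quotient.eq_zero_iff_mem, ← Submodule.mem_bot R, ← hbot, Submodule.mem_iInf]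
  intro n
  obtain ⟨a, ha, b, hb, rfl⟩ := Submodule.mem_sup.mp (h n)
  rw [map_add, Ideal.Quotient.eq_zero_iff_mem.mpr ha, zero_add]
  have : Ideal.Quotient.mk I b = b • (1 : R ⧸ I) := by
    rw [Algebra.smul_def, mul_one]
    rfl
  rw [this]
  exact Submodule.smul_mem_smul hb trivial

theorem tauI_le_annihilator_lic_bot {M : Type w} [AddCommGroup M] [Module R M]
    (hM : ∀ s : Finset M, ∃ h, ∀ m ∈ s, ∃ r : R, r • h = m) :
    tauI R ≤ (lic (⊥ : Submodule R M)).annihilator := by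
  intro a ha
  rw [Submodule.mem_annihilator]
  intro z hz
  obtain ⟨h, r, rfl, hr⟩ := exists_mem_idealClosure_of_mem_lic_bot hM hz
  have := mem_tauI_iff.mp ha _ r hr
  rwa [LinearMap.mem_ker, LinearMap.toSpanSingleton_apply, mul_smul] at this

theorem annihilator_lic_bot_le_tauI [IsLocalRing R] [IsNoetherianRing R] {M : Type w}
    [AddCommGroup M] [Module R M]
    (hM : ∀ I : Ideal R, I ≤ maximalIdeal R → maximalIdeal R ≤ I.radical →
      ∃ h : M, LinearMap.ker (LinearMap.toSpanSingleton R M h) ≤ I ∧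
        I ≤ icFree (LinearMap.ker (LinearMap.toSpanSingleton R M h) : Ideal R)) :
    (lic (⊥ : Submodule R M)).annihilator ≤ tauI R := by
  intro a ha
  rw [Submodule.mem_annihilator] at ha
  -- Krull's intersection theorem on R/I reduces the claim to the ideals I + m^n, which are
  -- m-primary unless they are the whole ring.
  refine mem_tauI_iff.mpr fun I z hz => mem_of_forall_mem_sup_pow fun n => ?_
  rcases eq_or_ne (I ⊔ maximalIdeal R ^ n) ⊤ with htop | hne
  · rw [htop]
    trivial
  have hrad : maximalIdeal R ≤ (I ⊔ maximalIdeal R ^ n).radical :=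
    fun x hx => ⟨n, Ideal.mem_sup_right (Ideal.pow_mem_pow hx n)⟩
  obtain ⟨h, hI, hI'⟩ := hM _ (IsLocalRing.le_maximalIdeal hne) hrad
  refine hI ?_
  rw [LinearMap.mem_ker, LinearMap.toSpanSingleton_apply, mul_smul]
  refine ha _ (smul_mem_lic_bot h ?_)
  rw [← mem_icFree_iff_mem_idealClosure]
  refine icFree_le_icFree_of_le hI' ?_
  rw [mem_icFree_iff_mem_idealClosure]
  exact idealClosure_mono le_sup_left hz

theorem tauI_le_annihilator_lic_localCohomology [IsLocalRing R] [IsNoetherianRing R] {d : ℕ}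
    (hd : ringKrullDim R = d) :
    tauI R ≤ (lic (⊥ : Submodule R
      ((localCohomology (maximalIdeal R) d).obj (ModuleCat.of R R)))).annihilator := by
  obtain ⟨xs, rfl, hxs⟩ := exists_isParameterSystem hd
  exact tauI_le_annihilator_lic_bot
    (exists_cyclic_localCohomology hxs.mem hxs.exists_pow_le_powIdeal)

theorem IsCohenMacaulay.annihilator_lic_localCohomology_le_tauI [IsLocalRing R]
    [IsNoetherianRing R] [Infinite (ResidueField R)] (hR : IsCohenMacaulay R) {d : ℕ}
    (hd : ringKrullDim R = d) :
    (lic (⊥ : Submodule R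
      ((localCohomology (maximalIdeal R) d).obj (ModuleCat.of R R)))).annihilator ≤ tauI R := by
  refine annihilator_lic_bot_le_tauI fun I hI hrad => ?_
  obtain ⟨xs, rfl, hxs, hle, hle'⟩ := exists_isParameterSystem_le_icFree hd hI hrad
  obtain ⟨h, hh⟩ := exists_smul_eq_zero_iff hxs.mem hxs.exists_pow_le_powIdeal
    (hR.exactAtLevel_koszul hxs) (hR.mem_powIdeal_one_of_mul_prod_pow_mem hxs)
  have hker : (LinearMap.ker (LinearMap.toSpanSingleton R _ h) : Ideal R) = Ideal.ofList xs := by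
    ext r
    rw [LinearMap.mem_ker, LinearMap.toSpanSingleton_apply, hh, powIdeal_one]
  exact ⟨h, hker.le.trans hle, hle'.trans (icFree_mono hker.ge)⟩

end Main

end LiftableIntegralClosure

theorem mainTheorem10 (R : Type u) [CommRing R] [IsLocalRing R] [IsNoetherianRing R]
    (d : ℕ) (hd : ringKrullDim R = d) :
    LiftableIntegralClosure.tauI R ≤
        (LiftableIntegralClosure.lic
          (⊥ : Submodule R ((localCohomology (maximalIdeal R) d).obj (ModuleCat.of R R)))).annihilator ∧
      (LiftableIntegralClosure.IsCohenMacaulay R → Infinite (ResidueField R) →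
        LiftableIntegralClosure.tauI R =
          (LiftableIntegralClosure.lic
            (⊥ : Submodule R
              ((localCohomology (maximalIdeal R) d).obj (ModuleCat.of R R)))).annihilator) := by
  refine ⟨LiftableIntegralClosure.tauI_le_annihilator_lic_localCohomology hd, fun hR _ => ?_⟩
  exact le_antisymm (LiftableIntegralClosure.tauI_le_annihilator_lic_localCohomology hd)
    (hR.annihilator_lic_localCohomology_le_tauI hd)
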